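/- Let $\lambda$ be the normalized area measure of the unit disk $\mathbb{D}$, let $A=\lambda\otimes\lambda\otimes\cdots$ on $\mathbb{D}^\infty$, and let $m$ be the normalized Haar measure of $\mathbb{T}^\infty$. Index the coordinates by the primes $p_1=2,p_2=3,\dots$. To a Dirichlet polynomial $P(s)=\sum_{n\le N}a_n n^{-s}$ associate the analytic polynomial $D(P)(z)=\sum_{n\le N}a_n z^{(n)}$, where $z^{(n)}=z_1^{\alpha_1}\cdots z_k^{\alpha_k}$ if $n=p_1^{\alpha_1}\cdots p_k^{\alpha_k}$. For $1\le p<\infty$ let $\mathcal{H}^p$ (resp. $\mathcal{B}^p$) be the closure of the Dirichlet polynomials for the norm $\|P\|_{\mathcal{H}^p}=\|D(P)\|_{L^p(\mathbb{T}^\infty,m)}$ (resp. $\|P\|_{\mathcal{B}^p}=\|D(P)\|_{L^p(\mathbb{D}^\infty,A)}$). The elements of both spaces are regarded as Dirichlet series $\sum a_n n^{-s}$. A bounded operator between Banach spaces is strictly singular if its restriction to any infinite-dimensional closed subspace is not an isomorphism onto its image. **Theorem.** Let $1\le p<\infty$. (i) The identity of Dirichlet series is a bounded operator from $\mathcal{H}^p$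 to $\mathcal{B}^{2p}$, of norm $1$. (ii) The identity of Dirichlet series is a bounded operator from $\mathcal{H}^p$ to $\mathcal{B}^p$ which is not compact, and in fact not strictly singular. More precisely, writing $e_q(s)=q^{-s}$, the closed linear spans of $\{e_q : q \text{ prime}\}$ in $\mathcal{H}^p$ and in $\mathcal{B}^p$ consist of the same Dirichlet series, namely the series $\sum_{q\text{ prime}}a_q q^{-s}$ with $\sum_q|a_q|^2<\infty$; on each of these spans the norm is equivalent to $(\sum_q|a_q|^2)^{1/2}$. -/

import Mathlib

open MeasureTheory
open scoped ENNReal ComplexConjugate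

namespace DirichletBergman

/-! ### Product measures on sequences of complex numbers indexed by the primes

The coordinates of the infinite polytorus and of the infinite polydisk are indexed by the primes
themselves (instead of by their rank). Both are regarded as subsets of `Nat.Primes → ℂ`, and their
reference measures as measures on that space. -/

/-- Probability measures on `ℂ` that are carried by the closed unit disk. -/
class DiskMeasure (ν : Measure ℂ) : Prop extends IsProbabilityMeasure ν where
  ae_norm_le_one : ∀ᵐ z ∂ν, ‖z‖ ≤ 1

/-- The normalized arc length measure `dθ / 2π` of the unit circle `𝕋`, as a measure on `ℂ`. -/
noncomputable def circleProb : Measure ℂ :=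
  (ProbabilityTheory.cond volume (Set.Ioc 0 (2 * Real.pi))).map (circleMap 0 1)

/-- The normalized area measure of the open unit disk `𝔻`, as a measure on `ℂ`. -/
noncomputable def diskProb : Measure ℂ :=
  ProbabilityTheory.cond volume (Metric.ball (0 : ℂ) 1)

instance : DiskMeasure circleProb where
  toIsProbabilityMeasure := by
    have h : IsProbabilityMeasure
        (ProbabilityTheory.cond (volume : Measure ℝ) (Set.Ioc 0 (2 * Real.pi))) :=
      ProbabilityTheory.cond_isProbabilityMeasure_of_finite
        (by simp [Real.volume_Ioc, Real.pi_pos])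
        (by rw [Real.volume_Ioc]; exact ENNReal.ofReal_ne_top)
    exact Measure.isProbabilityMeasure_map (measurable_circleMap 0 1).aemeasurable
  ae_norm_le_one := by
    unfold circleProb
    rw [ae_map_iff (measurable_circleMap 0 1).aemeasurable
      (measurableSet_le measurable_norm measurable_const)]
    exact Filter.Eventually.of_forall fun θ => by simp [circleMap]

instance : DiskMeasure diskProb where
  toIsProbabilityMeasure :=
    ProbabilityTheory.cond_isProbabilityMeasure_of_finite
      (Metric.measure_ball_pos volume _ one_pos).ne' measure_ball_lt_top.ne
  ae_norm_le_one := by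
    filter_upwards [ProbabilityTheory.ae_cond_mem (μ := (volume : Measure ℂ))
      (measurableSet_ball : MeasurableSet (Metric.ball (0 : ℂ) 1))] with z hz
    exact (mem_ball_zero_iff.1 hz).le

/-- The infinite product `ν ⊗ ν ⊗ ⋯`. For `ν = circleProb` it is the normalized Haar measure `m`
of the infinite polytorus `𝕋^∞`; for `ν = diskProb` it is the measure `A = λ ⊗ λ ⊗ ⋯` of the
infinite polydisk `𝔻^∞`. -/
noncomputable def polyMeasure (ν : Measure ℂ) [DiskMeasure ν] : Measure (Nat.Primes → ℂ) :=
  Measure.infinitePi fun _ => ν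

instance (ν : Measure ℂ) [DiskMeasure ν] : IsProbabilityMeasure (polyMeasure ν) := by
  unfold polyMeasure; infer_instance

/-! ### Bohr's correspondence -/

/-- The finite set of the prime divisors of `n`. -/
def primeDivisors (n : ℕ+) : Finset Nat.Primes :=
  (n : ℕ).primeFactors.subtype Nat.Prime

lemma mem_primeDivisors {n : ℕ+} {q : Nat.Primes} : q ∈ primeDivisors n ↔ (q : ℕ) ∣ n :=
  Finset.mem_subtype.trans
    ⟨fun h => Nat.dvd_of_mem_primeFactors h, fun h => Nat.mem_primeFactors.2 ⟨q.2, h, n.ne_zero⟩⟩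

/-- The monomial `z^(n) = ∏ z_q ^ α_q` attached to `n = ∏ q ^ α_q`. -/
noncomputable def bohrMonomial (n : ℕ+) (z : Nat.Primes → ℂ) : ℂ :=
  ∏ q ∈ primeDivisors n, z q ^ (n : ℕ).factorization q

/-- A finitely supported family `(a_n)` stands for the Dirichlet polynomial `∑ a_n n^{-s}`; this is
the associated analytic polynomial `∑ a_n z^(n)` in infinitely many variables. -/
noncomputable def bohrPoly (P : ℕ+ →₀ ℂ) (z : Nat.Primes → ℂ) : ℂ :=
  P.sum fun n a => a * bohrMonomial n z

lemma measurable_bohrMonomial (n : ℕ+) : Measurable (bohrMonomial n) :=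
  Finset.measurable_prod _ fun q _ => (measurable_pi_apply q).pow_const _

lemma memLp_bohrMonomial (ν : Measure ℂ) [DiskMeasure ν] (p : ℝ≥0∞) (n : ℕ+) :
    MemLp (bohrMonomial n) p (polyMeasure ν) := by
  refine MemLp.of_bound (measurable_bohrMonomial n).aestronglyMeasurable 1 ?_
  have h : ∀ᵐ z ∂polyMeasure ν, ∀ q : Nat.Primes, ‖z q‖ ≤ 1 := by
    rw [ae_all_iff]
    intro q
    exact (measurePreserving_eval_infinitePi (fun _ : Nat.Primes => ν) q).quasiMeasurePreserving.ae
      (DiskMeasure.ae_norm_le_one (ν := ν))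
  filter_upwards [h] with z hz
  unfold bohrMonomial
  rw [norm_prod]
  refine Finset.prod_le_one (fun _ _ => norm_nonneg _) fun q _ => ?_
  rw [norm_pow]
  exact pow_le_one₀ (norm_nonneg _) (hz q)

lemma memLp_bohrPoly (ν : Measure ℂ) [DiskMeasure ν] (p : ℝ≥0∞) (P : ℕ+ →₀ ℂ) :
    MemLp (bohrPoly P) p (polyMeasure ν) :=
  memLp_finsetSum _ fun n _ => (memLp_bohrMonomial ν p n).const_mul (P n)

/-- Bohr's correspondence `D`, from Dirichlet polynomials to `L^p`. -/
noncomputable def bohrLp (ν : Measure ℂ) [DiskMeasure ν] (p : ℝ≥0∞) :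
    (ℕ+ →₀ ℂ) →ₗ[ℂ] Lp ℂ p (polyMeasure ν) where
  toFun P := (memLp_bohrPoly ν p P).toLp (bohrPoly P)
  map_add' P Q := by
    rw [← MemLp.toLp_add]
    congr 1
    funext z
    exact Finsupp.sum_add_index' (fun _ => zero_mul _) fun _ _ _ => add_mul _ _ _
  map_smul' c P := by
    rw [RingHom.id_apply, ← MemLp.toLp_const_smul]
    congr 1
    funext z
    simp only [bohrPoly, Pi.smul_apply, smul_eq_mul]
    rw [Finsupp.sum_smul_index fun _ => zero_mul _, Finsupp.mul_sum]
    simp only [mul_assoc]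

/-! ### Hardy and Bergman spaces of Dirichlet series -/

/-- The closure of the Dirichlet polynomials for the norm `‖P‖ = ‖D(P)‖` of `L^p(ν ⊗ ν ⊗ ⋯)`. -/
noncomputable def DirichletSpace (ν : Measure ℂ) [DiskMeasure ν] (p : ℝ≥0∞) [Fact (1 ≤ p)] :
    Submodule ℂ (Lp ℂ p (polyMeasure ν)) :=
  (LinearMap.range (bohrLp ν p)).topologicalClosure

/-- The Hardy space `𝓗^p` of Dirichlet series. -/
noncomputable abbrev Hardy (p : ℝ≥0∞) [Fact (1 ≤ p)] := DirichletSpace circleProb p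

/-- The Bergman space `𝓑^p` of Dirichlet series. -/
noncomputable abbrev Bergman (p : ℝ≥0∞) [Fact (1 ≤ p)] := DirichletSpace diskProb p

/-- A Dirichlet polynomial as an element of `DirichletSpace ν p`. -/
noncomputable def ofPoly (ν : Measure ℂ) [DiskMeasure ν] (p : ℝ≥0∞) [Fact (1 ≤ p)]
    (P : ℕ+ →₀ ℂ) : DirichletSpace ν p :=
  ⟨bohrLp ν p P, Submodule.le_topologicalClosure _ ⟨P, rfl⟩⟩

/-- The `n`-th coefficient `a_n` of the Dirichlet series `∑ a_n n^{-s}` represented by an element of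
`DirichletSpace ν p`. The monomials are orthogonal in `L²`, so that this is
`⟨f, z^(n)⟩ / ‖z^(n)‖₂²`; the denominator is `1` for the polytorus, and `1 / d(n)` for the
polydisk, with `d(n)` the number of divisors of `n`. -/
noncomputable def coeff {ν : Measure ℂ} [DiskMeasure ν] {p : ℝ≥0∞} [Fact (1 ≤ p)]
    (f : DirichletSpace ν p) (n : ℕ+) : ℂ :=
  (∫ z, (f : Lp ℂ p (polyMeasure ν)) z * conj (bohrMonomial n z) ∂polyMeasure ν) /
    (∫ z, ‖bohrMonomial n z‖ ^ 2 ∂polyMeasure ν : ℝ)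

/-- The bounded operator `T` is the identity of Dirichlet series: it fixes every Dirichlet
polynomial, and for every `f` the Dirichlet series `T f` has the same coefficients as `f`. -/
structure IsIdentity {ν₁ ν₂ : Measure ℂ} [DiskMeasure ν₁] [DiskMeasure ν₂]
    {p₁ p₂ : ℝ≥0∞} [Fact (1 ≤ p₁)] [Fact (1 ≤ p₂)]
    (T : DirichletSpace ν₁ p₁ →L[ℂ] DirichletSpace ν₂ p₂) : Prop where
  map_ofPoly : ∀ P : ℕ+ →₀ ℂ, T (ofPoly ν₁ p₁ P) = ofPoly ν₂ p₂ P
  coeff_map : ∀ (f : DirichletSpace ν₁ p₁) (n : ℕ+), coeff (T f) n = coeff f n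

/-- The closed linear span of the functions `e_q(s) = q^{-s}`, for `q` prime. -/
noncomputable def primeSpan (ν : Measure ℂ) [DiskMeasure ν] (p : ℝ≥0∞) [Fact (1 ≤ p)] :
    Submodule ℂ (DirichletSpace ν p) :=
  (Submodule.span ℂ
    {f | ∃ n : ℕ+, Nat.Prime n ∧ f = ofPoly ν p (Finsupp.single n 1)}).topologicalClosure

/-- The linear homeomorphism `Φ`, from `ℓ²` over the primes to the closed span of the `e_q`, sends a
family `(a_q)` to the Dirichlet series `∑ a_q q^{-s}`. -/
def SendsToSeries {ν : Measure ℂ} [DiskMeasure ν] {p : ℝ≥0∞} [Fact (1 ≤ p)]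
    (Φ : lp (fun _ : Nat.Primes => ℂ) 2 ≃L[ℂ] primeSpan ν p) : Prop :=
  ∀ (a : lp (fun _ : Nat.Primes => ℂ) 2) (n : ℕ+),
    coeff (Φ a : DirichletSpace ν p) n = if h : Nat.Prime n then a ⟨n, h⟩ else 0

/-- A bounded operator is strictly singular if it is not an isomorphism onto its image on any
infinite-dimensional closed subspace. -/
def StrictlySingular {X Y : Type*} [NormedAddCommGroup X] [NormedSpace ℂ X]
    [NormedAddCommGroup Y] [NormedSpace ℂ Y] (T : X →L[ℂ] Y) : Prop :=
  ∀ M : Submodule ℂ X, IsClosed (M : Set X) → (∃ c : ℝ, 0 < c ∧ ∀ x ∈ M, c * ‖x‖ ≤ ‖T x‖) →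
    FiniteDimensional ℂ M

instance {p : ℝ≥0∞} [hp : Fact (1 ≤ p)] : Fact (1 ≤ 2 * p) :=
  ⟨hp.out.trans (le_mul_of_one_le_left zero_le one_le_two)⟩

end DirichletBergman

namespace DirichletBergman

/-! ### Rotation invariant measures on the disk -/

/-! Both parts are inequalities for Dirichlet polynomials, extended by density; coefficients are
continuous functionals, so the extended operators preserve them.

Part (i) is Carleman's inequality `‖f‖_{A^{2p}} ≤ ‖f‖_{H^p}`, first in one variable. For `p = 2` it
is Cauchy–Schwarz on the coefficients of `f²`: the `n`-th one has `n + 1` terms, and its square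
carries the weight `1/(n+1)` in `A²` (`integral_norm_eval_pow_four_le`). For other `p`, `|f|` is
replaced by the modulus `G` of its outer part, which is at least `|f|` inside the disk and equal to
it on the circle; since `G^(p/2)` is the modulus of a holomorphic function, the case `p = 2` applies
(`integral_norm_rpow_two_mul_le`). Several variables follow one at a time by Minkowski's inequality
(`lmarginal_enorm_rpow_two_mul_le`). The constant `1` shows that the norm is exactly `1`.

In part (ii) boundedness follows from (i), the measures being probabilities. Over the primes the
monomials are the coordinates, which are independent, centred and bounded. Khintchine's inequality
(`exists_norm_bohrLp_primePoly_equiv`) then makes both prime spans isomorphic to `ℓ²`, and the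
identity carries one isomorphism to the other. Since `ℓ²` is infinite-dimensional, this excludes
compactness and strict singularity. -/

/-- Rotation invariant probability measures on the closed unit disk without mass at the origin. -/
class RotationInvariant (ν : Measure ℂ) : Prop extends DiskMeasure ν where
  map_mul : ∀ u : ℂ, ‖u‖ = 1 → ν.map (u * ·) = ν
  ae_ne_zero : ∀ᵐ z ∂ν, z ≠ 0

lemma integral_circleProb {E : Type*} [NormedAddCommGroup E] [NormedSpace ℝ E] {f : ℂ → E}
    (hf : Continuous f) :
    ∫ z, f z ∂circleProb = (2 * Real.pi)⁻¹ • ∫ θ in (0 : ℝ)..(2 * Real.pi), f (circleMap 0 1 θ) := by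
  rw [circleProb, integral_map (measurable_circleMap 0 1).aemeasurable
    hf.aestronglyMeasurable, ProbabilityTheory.cond, integral_smul_measure,
    intervalIntegral.integral_of_le (by positivity), Real.volume_Ioc, sub_zero,
    ENNReal.toReal_inv, ENNReal.toReal_ofReal (by positivity)]

lemma ae_norm_eq_one_circleProb : ∀ᵐ z ∂circleProb, ‖z‖ = 1 := by
  unfold circleProb
  rw [ae_map_iff (measurable_circleMap 0 1).aemeasurable
    (measurableSet_eq_fun measurable_norm measurable_const)]
  exact Filter.Eventually.of_forall fun θ => by simp [circleMap]

instance : RotationInvariant circleProb where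
  map_mul u hu := by
    have : IsProbabilityMeasure (circleProb.map (u * ·)) :=
      Measure.isProbabilityMeasure_map (by fun_prop)
    refine ext_of_forall_integral_eq_of_IsFiniteMeasure fun f => ?_
    rw [integral_map (by fun_prop) f.continuous.aestronglyMeasurable,
      integral_circleProb f.continuous,
      integral_circleProb (f := fun z => f (u * z)) (f.continuous.comp (by fun_prop))]
    congr 1
    have hu' : u = Complex.exp (u.arg * Complex.I) := by
      conv_lhs => rw [← Complex.norm_mul_exp_arg_mul_I u, hu]
      simp
    have h : ∀ θ : ℝ, f (u * circleMap 0 1 θ) = f (circleMap 0 1 (θ + u.arg)) := by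
      intro θ
      congr 1
      conv_lhs => rw [hu']
      simp only [circleMap, Complex.ofReal_one, one_mul, zero_add, ← Complex.exp_add]
      congr 1
      push_cast
      ring
    simp_rw [h]
    -- Rotation by `u` shifts the angle by `arg u`, which does not change the integral over a full
    -- period.
    rw [intervalIntegral.integral_comp_add_right (fun θ => f (circleMap 0 1 θ))]
    have hp : Function.Periodic (fun θ => f (circleMap 0 1 θ)) (2 * Real.pi) := fun θ => by
      simp only [periodic_circleMap 0 1 θ]
    have := hp.intervalIntegral_add_eq u.arg 0
    rw [zero_add] at this
    rw [zero_add, add_comm (2 * Real.pi), this]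
  ae_ne_zero := by
    filter_upwards [ae_norm_eq_one_circleProb] with z hz h
    simp [h] at hz

instance : RotationInvariant diskProb where
  map_mul u hu := by
    have h : MeasurePreserving (u * ·) (volume : Measure ℂ) volume := by
      simpa using! (rotation ⟨u, by simpa [Submonoid.unitSphere] using hu⟩).measurePreserving
    rw [diskProb, ProbabilityTheory.cond, Measure.map_smul]
    congr 1
    have hpre : (u * ·) ⁻¹' Metric.ball (0 : ℂ) 1 = Metric.ball 0 1 := by
      ext z
      simp [hu]
    have := (h.restrict_preimage (s := Metric.ball (0 : ℂ) 1) measurableSet_ball).map_eq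
    rwa [hpre] at this
  ae_ne_zero :=
    ProbabilityTheory.cond_absolutelyContinuous.ae_le
      (compl_mem_ae_iff.2 (measure_singleton (0 : ℂ)))

lemma exists_unit_pow_mul_conj_pow_ne_one {a b : ℕ} (h : a ≠ b) :
    ∃ u : ℂ, ‖u‖ = 1 ∧ u ^ a * conj u ^ b ≠ 1 := by
  have hab : ((a : ℂ) - b) ≠ 0 := sub_ne_zero.2 (by exact_mod_cast h)
  -- The angle is chosen so that the product is `e^{iπ} = -1`.
  refine ⟨Complex.exp ((Real.pi / ((a : ℝ) - b) : ℝ) * Complex.I),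
    Complex.norm_exp_ofReal_mul_I _, ?_⟩
  rw [← Complex.exp_conj, ← Complex.exp_nat_mul, ← Complex.exp_nat_mul, ← Complex.exp_add]
  have : (a : ℂ) * ((Real.pi / ((a : ℝ) - b) : ℝ) * Complex.I)
      + b * conj ((Real.pi / ((a : ℝ) - b) : ℝ) * Complex.I) = Real.pi * Complex.I := by
    rw [map_mul, Complex.conj_ofReal, Complex.conj_I]
    push_cast
    field_simp
    ring
  rw [this, Complex.exp_pi_mul_I]
  norm_num

/-- The substitution `z ↦ uz` multiplies the integral by `u^a * conj u^b`; one value of this factor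
different from `1` forces the integral to vanish. -/
lemma integral_pow_mul_conj_pow (ν : Measure ℂ) [hν : RotationInvariant ν] {a b : ℕ} (h : a ≠ b) :
    ∫ z, z ^ a * conj z ^ b ∂ν = 0 := by
  obtain ⟨u, hu, hne⟩ := exists_unit_pow_mul_conj_pow_ne_one h
  have key : ∫ z, z ^ a * conj z ^ b ∂ν = (u ^ a * conj u ^ b) * ∫ z, z ^ a * conj z ^ b ∂ν := by
    conv_lhs => rw [← hν.map_mul u hu]
    rw [integral_map (by fun_prop) (Continuous.aestronglyMeasurable (by fun_prop)),
      ← integral_const_mul]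
    congr 1
    funext z
    rw [map_mul]
    ring
  by_contra h0
  exact hne (mul_right_cancel₀ h0 (by rw [one_mul]; exact key.symm))

lemma integral_norm_pow_circleProb (k : ℕ) : ∫ z, ‖z‖ ^ k ∂circleProb = 1 := by
  have : (fun z : ℂ => ‖z‖ ^ k) =ᵐ[circleProb] fun _ => 1 := by
    filter_upwards [ae_norm_eq_one_circleProb] with z hz
    simp [hz]
  simp [integral_congr_ae this]

/-- In polar coordinates this is `2 ∫₀¹ r^(2k+1) dr`. -/
lemma integral_norm_pow_diskProb (k : ℕ) : ∫ z, ‖z‖ ^ (2 * k) ∂diskProb = ((k : ℝ) + 1)⁻¹ := by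
  have h1 : ∫ z in Metric.ball (0 : ℂ) 1, ‖z‖ ^ (2 * k)
      = ∫ z : ℂ, (Set.Iio (1 : ℝ)).indicator (fun r => r ^ (2 * k)) ‖z‖ := by
    rw [← integral_indicator measurableSet_ball]
    congr 1
    funext z
    simp [Set.indicator]
  have h2 : ∫ y in Set.Ioi (0 : ℝ), y ^ (2 - 1) • (Set.Iio (1 : ℝ)).indicator
      (fun r => r ^ (2 * k)) y = (2 * (k : ℝ) + 2)⁻¹ := by
    have : ∀ y : ℝ, y ^ (2 - 1) • (Set.Iio (1 : ℝ)).indicator (fun r => r ^ (2 * k)) y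
        = (Set.Iio (1 : ℝ)).indicator (fun r => r ^ (2 * k + 1)) y := by
      intro y
      by_cases hy : y < 1 <;> simp [Set.indicator, hy, pow_succ, mul_comm]
    simp_rw [this]
    rw [setIntegral_indicator measurableSet_Iio, Set.Ioi_inter_Iio, ← integral_Ioc_eq_integral_Ioo,
      ← intervalIntegral.integral_of_le zero_le_one, integral_pow]
    push_cast
    simp
    ring
  rw [diskProb, ProbabilityTheory.cond, integral_smul_measure, h1, integral_fun_norm_addHaar,
    Complex.finrank_real_complex, h2, ENNReal.toReal_inv]
  have hpos : (volume : Measure ℂ).real (Metric.ball 0 1) ≠ 0 := by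
    rw [Measure.real, Complex.volume_ball]
    simp [Real.pi_pos.ne']
  simp only [Measure.real, smul_eq_mul, nsmul_eq_mul] at hpos ⊢
  rw [show (2 * (k : ℝ) + 2) = 2 * (k + 1) by ring]
  have : (k : ℝ) + 1 ≠ 0 := by positivity
  push_cast
  field_simp

/-! ### Carleman's inequality in one variable -/

lemma ae_of_forall_norm_le_one (ν : Measure ℂ) [hν : DiskMeasure ν] {P : ℂ → Prop}
    (h : ∀ z, ‖z‖ ≤ 1 → P z) : ∀ᵐ z ∂ν, P z :=
  hν.ae_norm_le_one.mono h

lemma integrable_of_continuous (ν : Measure ℂ) [DiskMeasure ν] {E : Type*} [NormedAddCommGroup E]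
    [SecondCountableTopologyEither ℂ E] {f : ℂ → E} (hf : Continuous f) : Integrable f ν := by
  obtain ⟨C, hC⟩ := (isCompact_closedBall (0 : ℂ) 1).exists_bound_of_continuousOn hf.continuousOn
  exact Integrable.of_bound hf.aestronglyMeasurable C
    (ae_of_forall_norm_le_one ν fun z hz => hC z (by simpa using hz))

lemma tendsto_integral_of_bound (ν : Measure ℂ) [DiskMeasure ν] {F : ℕ → ℂ → ℝ} {G : ℂ → ℝ}
    (C : ℝ) (hF : ∀ n, Continuous (F n)) (hC : ∀ n z, ‖z‖ ≤ 1 → ‖F n z‖ ≤ C)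
    (hG : ∀ z, ‖z‖ ≤ 1 → Filter.Tendsto (F · z) Filter.atTop (nhds (G z))) :
    Filter.Tendsto (fun n => ∫ z, F n z ∂ν) Filter.atTop (nhds (∫ z, G z ∂ν)) :=
  tendsto_integral_of_dominated_convergence (fun _ => C)
    (fun n => (hF n).aestronglyMeasurable) (integrable_const C)
    (fun n => ae_of_forall_norm_le_one ν (hC n)) (ae_of_forall_norm_le_one ν hG)

/-- Parseval: rotation invariance kills the cross terms. The bound `N` is left free so that
polynomials of different degrees can be summed over a common range. -/
lemma integral_norm_sq_eval (ν : Measure ℂ) [RotationInvariant ν] (f : Polynomial ℂ) {N : ℕ}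
    (hN : f.natDegree < N) :
    ∫ z, ‖f.eval z‖ ^ 2 ∂ν = ∑ k ∈ Finset.range N, ‖f.coeff k‖ ^ 2 * ∫ z, ‖z‖ ^ (2 * k) ∂ν := by
  apply Complex.ofReal_injective
  rw [← integral_complex_ofReal]
  have h1 : ∀ z : ℂ, ((‖f.eval z‖ ^ 2 : ℝ) : ℂ) = ∑ i ∈ Finset.range N, ∑ j ∈ Finset.range N,
      (f.coeff i * conj (f.coeff j)) * (z ^ i * conj z ^ j) := by
    intro z
    rw [Complex.ofReal_pow, ← Complex.mul_conj', Polynomial.eval_eq_sum_range' hN, map_sum,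
      Finset.sum_mul_sum]
    refine Finset.sum_congr rfl fun i _ => Finset.sum_congr rfl fun j _ => ?_
    rw [map_mul, map_pow]
    ring
  simp_rw [h1]
  have hint : ∀ i j : ℕ, Integrable
      (fun z : ℂ => (f.coeff i * conj (f.coeff j)) * (z ^ i * conj z ^ j)) ν :=
    fun i j => integrable_of_continuous ν (by fun_prop)
  rw [integral_finsetSum _ fun i _ => integrable_finsetSum _ fun j _ => hint i j, Complex.ofReal_sum]
  refine Finset.sum_congr rfl fun i hi => ?_
  rw [integral_finsetSum _ fun j _ => hint i j, Finset.sum_eq_single i]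
  · rw [integral_const_mul, Complex.mul_conj', Complex.ofReal_mul, Complex.ofReal_pow,
      ← integral_complex_ofReal]
    congr 2
    funext z
    rw [← mul_pow, Complex.mul_conj', pow_mul, Complex.ofReal_pow, Complex.ofReal_pow]
  · intro j _ hj
    rw [integral_const_mul, integral_pow_mul_conj_pow ν hj.symm, mul_zero]
  · exact fun h => absurd hi h

lemma integral_norm_eval_pow_four_le (f : Polynomial ℂ) :
    ∫ z, ‖f.eval z‖ ^ 4 ∂diskProb ≤ (∫ z, ‖f.eval z‖ ^ 2 ∂circleProb) ^ 2 := by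
  set N := f.natDegree + 1 with hN
  have hfN : f.natDegree < N := Nat.lt_succ_self _
  -- `B(1)` is the squared `H²` norm of `f`, so the right-hand side is `(B * B)(1)`, to be compared
  -- with `f * f` coefficient by coefficient.
  set B : Polynomial ℝ := ∑ i ∈ Finset.range N, Polynomial.monomial i (‖f.coeff i‖ ^ 2) with hB
  have hBc : ∀ i, B.coeff i = ‖f.coeff i‖ ^ 2 := by
    intro i
    rw [hB, Polynomial.finsetSum_coeff]
    simp only [Polynomial.coeff_monomial, Finset.sum_ite_eq', Finset.mem_range]
    split_ifs with h
    · rfl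
    · rw [Polynomial.coeff_eq_zero_of_natDegree_lt (by omega)]
      simp
  have hBd : B.natDegree < N := by
    rw [hN, Nat.lt_succ_iff, Polynomial.natDegree_le_iff_coeff_eq_zero]
    intro n hn
    rw [hBc, Polynomial.coeff_eq_zero_of_natDegree_lt hn]
    simp
  have hcirc : ∫ z, ‖f.eval z‖ ^ 2 ∂circleProb = B.eval 1 := by
    rw [integral_norm_sq_eval circleProb f hfN, Polynomial.eval_eq_sum_range' hBd]
    refine Finset.sum_congr rfl fun k _ => ?_
    rw [integral_norm_pow_circleProb, hBc, one_pow]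
  have h4 : ∀ z, ‖f.eval z‖ ^ 4 = ‖(f * f).eval z‖ ^ 2 := by
    intro z
    rw [Polynomial.eval_mul, norm_mul]
    ring
  have hff : (f * f).natDegree < 2 * N := by
    have := Polynomial.natDegree_mul_le (p := f) (q := f)
    omega
  have hBB : (B * B).natDegree < 2 * N := by
    have := Polynomial.natDegree_mul_le (p := B) (q := B)
    omega
  simp_rw [h4]
  rw [integral_norm_sq_eval diskProb _ hff, hcirc, pow_two (B.eval 1), ← Polynomial.eval_mul,
    Polynomial.eval_eq_sum_range' hBB]
  refine Finset.sum_le_sum fun n _ => ?_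
  rw [integral_norm_pow_diskProb, one_pow, mul_one, ← div_eq_mul_inv, div_le_iff₀ (by positivity),
    Polynomial.coeff_mul, Polynomial.coeff_mul, mul_comm]
  -- Cauchy–Schwarz over the `n + 1` pairs of sum `n`; this cardinality cancels the weight
  -- `1/(n+1)`.
  have h := sq_sum_le_card_mul_sum_sq (s := Finset.HasAntidiagonal.antidiagonal n)
    (f := fun x : ℕ × ℕ => ‖f.coeff x.1 * f.coeff x.2‖)
  rw [Finset.Nat.card_antidiagonal] at h
  push_cast at h
  refine (pow_le_pow_left₀ (norm_nonneg _) (norm_sum_le _ _) 2).trans (h.trans_eq ?_)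
  congr 1
  refine Finset.sum_congr rfl fun x _ => ?_
  rw [hBc, hBc, norm_mul, mul_pow]

/-- As `R > 1`, the Taylor coefficients are absolutely summable, so the Taylor polynomials are
uniformly bounded on the closed disk and dominated convergence applies. -/
lemma integral_norm_pow_four_le {h : ℂ → ℂ} {R : NNReal} (hR : 1 < R)
    (hd : DifferentiableOn ℂ h (Metric.closedBall 0 R)) :
    ∫ z, ‖h z‖ ^ 4 ∂diskProb ≤ (∫ z, ‖h z‖ ^ 2 ∂circleProb) ^ 2 := by
  have hps := hd.hasFPowerSeriesOnBall (zero_lt_one.trans hR)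
  set p := cauchyPowerSeries h 0 R
  have hsum : Summable fun k => ‖p.coeff k‖ := by
    have := p.summable_norm_mul_pow (r := 1)
      (lt_of_lt_of_le (by exact_mod_cast hR) hps.r_le)
    simpa [FormalMultilinearSeries.norm_apply_eq_norm_coef] using this
  set S := ∑' k, ‖p.coeff k‖
  set H : ℕ → Polynomial ℂ := fun n => ∑ k ∈ Finset.range n, Polynomial.monomial k (p.coeff k)
  have hH : ∀ n z, (H n).eval z = ∑ k ∈ Finset.range n, p.coeff k * z ^ k := by
    intro n z
    simp [H, Polynomial.eval_finsetSum]
  have hbd : ∀ n z, ‖z‖ ≤ 1 → ‖(H n).eval z‖ ≤ S := by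
    intro n z hz
    rw [hH]
    refine (norm_sum_le _ _).trans ((Finset.sum_le_sum fun k _ => ?_).trans
      (hsum.sum_le_tsum (Finset.range n) fun _ _ => norm_nonneg _))
    rw [norm_mul, norm_pow]
    exact mul_le_of_le_one_right (norm_nonneg _) (pow_le_one₀ (norm_nonneg _) hz)
  have hlim : ∀ z, ‖z‖ ≤ 1 →
      Filter.Tendsto (fun n => (H n).eval z) Filter.atTop (nhds (h z)) := by
    intro z hz
    have hz' : z ∈ Metric.eball (0 : ℂ) R := by
      rw [mem_eball_zero_iff, enorm_eq_nnnorm]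
      exact_mod_cast lt_of_le_of_lt hz hR
    have := (hps.hasSum hz').tendsto_sum_nat
    simp only [zero_add, FormalMultilinearSeries.apply_eq_pow_smul_coeff, smul_eq_mul] at this
    refine this.congr fun n => ?_
    rw [hH]
    exact Finset.sum_congr rfl fun k _ => mul_comm _ _
  have hpow : ∀ m : ℕ, ∀ n z, ‖z‖ ≤ 1 → ‖‖(H n).eval z‖ ^ m‖ ≤ S ^ m := by
    intro m n z hz
    rw [norm_pow, norm_norm]
    exact pow_le_pow_left₀ (norm_nonneg _) (hbd n z hz) m
  have hT : ∀ (ν : Measure ℂ) [DiskMeasure ν] (m : ℕ),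
      Filter.Tendsto (fun n => ∫ z, ‖(H n).eval z‖ ^ m ∂ν) Filter.atTop
        (nhds (∫ z, ‖h z‖ ^ m ∂ν)) := fun ν _ m =>
    tendsto_integral_of_bound ν (S ^ m) (fun n => by fun_prop) (hpow m)
      fun z hz => ((hlim z hz).norm).pow m
  exact le_of_tendsto_of_tendsto' (hT diskProb 4) ((hT circleProb 2).pow 2)
    fun n => integral_norm_eval_pow_four_le (H n)

/-- The function `G` dominates `|f|` on the closed unit disk, agrees with it on the unit circle, and
all its powers are moduli of holomorphic functions on the open disk. For a polynomial `f` it is the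
modulus of the outer part of `f`. -/
structure IsOuterModulus (f : ℂ → ℂ) (G : ℂ → ℝ) : Prop where
  continuous : Continuous G
  norm_le : ∀ z, ‖z‖ ≤ 1 → ‖f z‖ ≤ G z
  norm_eq : ∀ z, ‖z‖ = 1 → ‖f z‖ = G z
  nonneg : ∀ z, 0 ≤ G z
  exists_rpow : ∀ s : ℝ, 0 < s → ∃ h : ℂ → ℂ, DifferentiableOn ℂ h (Metric.ball 0 1) ∧
    ∀ z ∈ Metric.ball (0 : ℂ) 1, ‖h z‖ = G z ^ s

lemma isOuterModulus_const (c : ℂ) : IsOuterModulus (fun _ => c) (fun _ => ‖c‖) where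
  continuous := continuous_const
  norm_le _ _ := le_rfl
  norm_eq _ _ := rfl
  nonneg _ := norm_nonneg c
  exists_rpow s _ := ⟨fun _ => ((‖c‖ ^ s : ℝ) : ℂ), differentiableOn_const _, fun z _ => by
    rw [Complex.norm_real, Real.norm_of_nonneg (by positivity)]⟩

lemma IsOuterModulus.mul {f₁ f₂ : ℂ → ℂ} {G₁ G₂ : ℂ → ℝ} (h₁ : IsOuterModulus f₁ G₁)
    (h₂ : IsOuterModulus f₂ G₂) :
    IsOuterModulus (fun z => f₁ z * f₂ z) (fun z => G₁ z * G₂ z) where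
  continuous := h₁.continuous.mul h₂.continuous
  norm_le z hz := by
    rw [norm_mul]
    exact mul_le_mul (h₁.norm_le z hz) (h₂.norm_le z hz) (norm_nonneg _) (h₁.nonneg z)
  norm_eq z hz := by rw [norm_mul, h₁.norm_eq z hz, h₂.norm_eq z hz]
  nonneg z := mul_nonneg (h₁.nonneg z) (h₂.nonneg z)
  exists_rpow s hs := by
    obtain ⟨g₁, hd₁, hg₁⟩ := h₁.exists_rpow s hs
    obtain ⟨g₂, hd₂, hg₂⟩ := h₂.exists_rpow s hs
    refine ⟨fun z => g₁ z * g₂ z, hd₁.mul hd₂, fun z hz => ?_⟩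
    rw [norm_mul, hg₁ z hz, hg₂ z hz, Real.mul_rpow (h₁.nonneg z) (h₂.nonneg z)]

/-- On the open disk `1 - bz` has positive real part, so the principal branch of its power is
holomorphic. -/
lemma exists_rpow_one_sub_mul {b : ℂ} (hb : ‖b‖ ≤ 1) (s : ℝ) :
    ∃ h : ℂ → ℂ, DifferentiableOn ℂ h (Metric.ball 0 1) ∧
      ∀ z ∈ Metric.ball (0 : ℂ) 1, ‖h z‖ = ‖1 - b * z‖ ^ s := by
  refine ⟨fun z => (1 - b * z) ^ (s : ℂ), ?_, fun z _ => Complex.norm_cpow_real _ _⟩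
  refine DifferentiableOn.cpow_const (by fun_prop) fun z hz => ?_
  left
  have h1 : ‖b * z‖ < 1 := by
    rw [norm_mul]
    exact (mul_le_of_le_one_left (norm_nonneg _) hb).trans_lt (by simpa using hz)
  have h2 := (Complex.re_le_norm (b * z)).trans_lt h1
  simpa using h2

/-- If `‖a‖ ≤ 1`, dividing out the Blaschke factor turns `z - a` into `1 - conj a * z`. If `‖a‖ ≥
1`, there is no zero in the open disk and `z - a` is already outer. -/
lemma exists_isOuterModulus_sub (a : ℂ) : ∃ G, IsOuterModulus (fun z => z - a) G := by
  rcases le_total ‖a‖ 1 with ha | ha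
  -- The right side is nonnegative on the closed disk and zero on the circle, which gives both the
  -- domination and the equality.
  · have key : ∀ z : ℂ, ‖1 - conj a * z‖ ^ 2 - ‖z - a‖ ^ 2 = (1 - ‖a‖ ^ 2) * (1 - ‖z‖ ^ 2) := by
      intro z
      simp only [← Complex.normSq_eq_norm_sq, Complex.normSq_apply, Complex.sub_re, Complex.sub_im,
        Complex.mul_re, Complex.mul_im, Complex.conj_re, Complex.conj_im, Complex.one_re,
        Complex.one_im]
      ring
    refine ⟨fun z => ‖1 - conj a * z‖, by fun_prop, fun z hz => ?_, fun z hz => ?_,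
      fun z => norm_nonneg _, fun s _ => exists_rpow_one_sub_mul (by simpa using ha) s⟩
    · have h1 : 0 ≤ (1 - ‖a‖ ^ 2) * (1 - ‖z‖ ^ 2) :=
        mul_nonneg (sub_nonneg.2 (pow_le_one₀ (norm_nonneg _) ha))
          (sub_nonneg.2 (pow_le_one₀ (norm_nonneg _) hz))
      refine (sq_le_sq₀ (norm_nonneg _) (norm_nonneg _)).1 ?_
      have := key z
      linarith
    · have h := key z
      rw [hz] at h
      refine (sq_eq_sq₀ (norm_nonneg _) (norm_nonneg _)).1 ?_
      linarith
  · have ha0 : a ≠ 0 := norm_pos_iff.1 (zero_lt_one.trans_le ha)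
    have key : ∀ z, ‖z - a‖ = ‖a‖ * ‖1 - a⁻¹ * z‖ := by
      intro z
      rw [← norm_mul, mul_sub, mul_inv_cancel_left₀ ha0, mul_one, norm_sub_rev]
    refine ⟨fun z => ‖z - a‖, by fun_prop, fun z _ => le_rfl, fun z _ => rfl,
      fun z => norm_nonneg _, fun s _ => ?_⟩
    obtain ⟨h, hd, hh⟩ := exists_rpow_one_sub_mul (b := a⁻¹)
      (by rw [norm_inv]; exact inv_le_one_of_one_le₀ ha) s
    refine ⟨fun z => ((‖a‖ ^ s : ℝ) : ℂ) * h z, hd.const_mul _, fun z hz => ?_⟩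
    rw [norm_mul, hh z hz, key, Real.mul_rpow (norm_nonneg _) (norm_nonneg _), Complex.norm_real,
      Real.norm_of_nonneg (by positivity)]

lemma exists_isOuterModulus (f : Polynomial ℂ) : ∃ G, IsOuterModulus (fun z => f.eval z) G := by
  have hprod : ∀ m : Multiset ℂ,
      ∃ G, IsOuterModulus (fun z => ((m.map fun a => Polynomial.X - Polynomial.C a).prod).eval z) G := by
    intro m
    induction m using Multiset.induction with
    | empty => exact ⟨_, by simpa using isOuterModulus_const 1⟩
    | cons a m ih =>
      obtain ⟨G₁, h₁⟩ := exists_isOuterModulus_sub a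
      obtain ⟨G₂, h₂⟩ := ih
      exact ⟨_, by simpa using h₁.mul h₂⟩
  obtain ⟨G, hG⟩ := hprod f.roots
  have hf := (IsAlgClosed.splits f).eq_prod_roots
  rw [hf]
  exact ⟨_, by simpa only [Polynomial.eval_mul, Polynomial.eval_C] using
    (isOuterModulus_const f.leadingCoeff).mul hG⟩

/-- Carleman's inequality: the identity of polynomials is a contraction from the Hardy space `H^p`
of the disk to the Bergman space `A^{2p}`. -/
theorem integral_norm_rpow_two_mul_le (f : Polynomial ℂ) {p : ℝ} (hp : 0 < p) :
    ∫ z, ‖f.eval z‖ ^ (2 * p) ∂diskProb ≤ (∫ z, ‖f.eval z‖ ^ p ∂circleProb) ^ 2 := by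
  obtain ⟨G, hG⟩ := exists_isOuterModulus f
  -- With exponent `p / 2`, `|h|² = G^p` and `|h|⁴ = G^(2p)`.
  obtain ⟨h, hd, hh⟩ := hG.exists_rpow (p / 2) (by positivity)
  -- `h` is holomorphic on the open disk only, hence the dilations by `r n → 1`; the shift by `2`
  -- keeps `r 0` positive.
  set r : ℕ → ℝ := fun n => 1 - 1 / ((n : ℝ) + 2)
  have hr0 : ∀ n, 0 < r n := fun n => by
    have : (1 : ℝ) / ((n : ℝ) + 2) < 1 := by
      rw [div_lt_one (by positivity)]
      have : (0 : ℝ) ≤ n := n.cast_nonneg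
      linarith
    simp only [r]
    linarith
  have hr1 : ∀ n, r n < 1 := fun n => by
    have : (0 : ℝ) < 1 / ((n : ℝ) + 2) := by positivity
    simp only [r]
    linarith
  have hrlim : Filter.Tendsto r Filter.atTop (nhds 1) := by
    have : Filter.Tendsto (fun n : ℕ => 1 / ((n : ℝ) + 2)) Filter.atTop (nhds 0) :=
      tendsto_const_nhds.div_atTop
        (Filter.tendsto_atTop_add_const_right _ _ tendsto_natCast_atTop_atTop)
    simpa [r] using (tendsto_const_nhds (x := (1 : ℝ))).sub this
  have hmem : ∀ n z, ‖z‖ ≤ 1 → (r n : ℂ) * z ∈ Metric.ball (0 : ℂ) 1 := by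
    intro n z hz
    rw [mem_ball_zero_iff, norm_mul, Complex.norm_real, Real.norm_of_nonneg (hr0 n).le]
    exact (mul_le_of_le_one_right (hr0 n).le hz).trans_lt (hr1 n)
  have hpow : ∀ (m : ℕ) (n : ℕ) (z : ℂ), ‖z‖ ≤ 1 →
      ‖h (r n * z)‖ ^ m = G (r n * z) ^ (p / 2 * m) := by
    intro m n z hz
    rw [hh _ (hmem n z hz), ← Real.rpow_natCast, ← Real.rpow_mul (hG.nonneg _)]
  have hstep : ∀ n, ∫ z, G (r n * z) ^ (2 * p) ∂diskProb
      ≤ (∫ z, G (r n * z) ^ p ∂circleProb) ^ 2 := by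
    intro n
    -- Any `R` between `1` and `1 / r n` keeps `r n * z` in the open disk for `‖z‖ ≤ R`.
    obtain ⟨R, hR1, hR2⟩ := exists_between ((one_lt_inv₀ (hr0 n)).2 (hr1 n))
    have hR0 : 0 < R := zero_lt_one.trans hR1
    have hd' : DifferentiableOn ℂ (fun z => h (r n * z))
        (Metric.closedBall 0 ((⟨R, hR0.le⟩ : NNReal) : ℝ)) := by
      refine hd.comp (by fun_prop) fun z hz => ?_
      rw [mem_ball_zero_iff, norm_mul, Complex.norm_real, Real.norm_of_nonneg (hr0 n).le]
      have hz' : ‖z‖ ≤ R := by simpa using hz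
      calc r n * ‖z‖ ≤ r n * R := mul_le_mul_of_nonneg_left hz' (hr0 n).le
        _ < r n * (r n)⁻¹ := mul_lt_mul_of_pos_left hR2 (hr0 n)
        _ = 1 := mul_inv_cancel₀ (hr0 n).ne'
    have := integral_norm_pow_four_le (R := ⟨R, hR0.le⟩) hR1 hd'
    rw [integral_congr_ae (ae_of_forall_norm_le_one diskProb (hpow 4 n)),
      integral_congr_ae (ae_of_forall_norm_le_one circleProb (hpow 2 n))] at this
    convert this using 4 <;> push_cast <;> ring_nf
  have hcont : ∀ s : ℝ, 0 < s → Continuous fun z => G z ^ s := fun s hs =>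
    hG.continuous.rpow_const fun _ => Or.inr hs.le
  have hT : ∀ (ν : Measure ℂ) [DiskMeasure ν] (s : ℝ), 0 < s →
      Filter.Tendsto (fun n => ∫ z, G (r n * z) ^ s ∂ν) Filter.atTop (nhds (∫ z, G z ^ s ∂ν)) := by
    intro ν _ s hs
    obtain ⟨C, hC⟩ := (isCompact_closedBall (0 : ℂ) 1).exists_bound_of_continuousOn
      (hcont s hs).continuousOn
    refine tendsto_integral_of_bound ν C (fun n => (hcont s hs).comp (by fun_prop))
      (fun n z hz => hC _ (Metric.ball_subset_closedBall (hmem n z hz))) fun z _ => ?_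
    refine ((hcont s hs).tendsto z).comp ?_
    have := ((Complex.continuous_ofReal.tendsto 1).comp hrlim).mul_const z
    simpa using this
  have hlim := le_of_tendsto_of_tendsto' (hT diskProb (2 * p) (by positivity))
    ((hT circleProb p hp).pow 2) hstep
  have hint : ∀ s : ℝ, 0 < s → Continuous fun z : ℂ => ‖f.eval z‖ ^ s := fun s hs =>
    (by fun_prop : Continuous fun z : ℂ => ‖f.eval z‖).rpow_const fun _ => Or.inr hs.le
  calc ∫ z, ‖f.eval z‖ ^ (2 * p) ∂diskProb ≤ ∫ z, G z ^ (2 * p) ∂diskProb :=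
        integral_mono_ae (integrable_of_continuous _ (hint _ (by positivity)))
          (integrable_of_continuous _ (hcont _ (by positivity)))
          (ae_of_forall_norm_le_one diskProb fun z hz =>
            Real.rpow_le_rpow (norm_nonneg _) (hG.norm_le z hz) (by positivity))
    _ ≤ _ := hlim
    _ = (∫ z, ‖f.eval z‖ ^ p ∂circleProb) ^ 2 := by
        congr 1
        refine integral_congr_ae ?_
        filter_upwards [ae_norm_eq_one_circleProb] with z hz
        rw [hG.norm_eq z hz]

theorem lintegral_enorm_rpow_two_mul_le (f : Polynomial ℂ) {p : ℝ} (hp : 0 < p) :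
    ∫⁻ z, ‖f.eval z‖ₑ ^ (2 * p) ∂diskProb ≤ (∫⁻ z, ‖f.eval z‖ₑ ^ p ∂circleProb) ^ 2 := by
  have key : ∀ (ν : Measure ℂ) [DiskMeasure ν] (s : ℝ), 0 < s →
      ∫⁻ z, ‖f.eval z‖ₑ ^ s ∂ν = ENNReal.ofReal (∫ z, ‖f.eval z‖ ^ s ∂ν) := by
    intro ν _ s hs
    rw [ofReal_integral_eq_lintegral_ofReal (integrable_of_continuous ν
      ((by fun_prop : Continuous fun z : ℂ => ‖f.eval z‖).rpow_const fun _ => Or.inr hs.le))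
      (Filter.Eventually.of_forall fun z => by positivity)]
    refine lintegral_congr fun z => ?_
    rw [← ofReal_norm, ENNReal.ofReal_rpow_of_nonneg (norm_nonneg _) hs.le]
  rw [key diskProb _ (by positivity), key circleProb p hp, ← ENNReal.ofReal_pow
    (integral_nonneg fun z => by positivity)]
  exact ENNReal.ofReal_le_ofReal (integral_norm_rpow_two_mul_le f hp)

/-! ### Carleman's inequality in several variables -/

/-- Minkowski's integral inequality in `L²`. -/
lemma lintegral_lintegral_sq_le {α β : Type*} [MeasurableSpace α] [MeasurableSpace β]
    {μ : Measure α} {ν : Measure β} [SFinite μ] [SFinite ν] {G : α → β → ℝ≥0∞}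
    (hG : Measurable (Function.uncurry G)) :
    ∫⁻ y, (∫⁻ x, G x y ∂μ) ^ 2 ∂ν ≤ (∫⁻ x, (∫⁻ y, G x y ^ 2 ∂ν) ^ (1 / 2 : ℝ) ∂μ) ^ 2 := by
  have hx : ∀ y, Measurable fun x => G x y := fun y => hG.comp measurable_prodMk_right
  have hy : ∀ x, Measurable fun y => G x y := fun x => hG.comp measurable_prodMk_left
  -- Written as a double integral, the square reduces the claim to Tonelli and Cauchy–Schwarz in
  -- `y`.
  have sq_eq : ∀ {γ : Type _} [MeasurableSpace γ] {κ : Measure γ} {f : γ → ℝ≥0∞}, Measurable f →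
      (∫⁻ x, f x ∂κ) ^ 2 = ∫⁻ x, ∫⁻ x', f x * f x' ∂κ ∂κ := by
    intro γ _ κ f hf
    rw [pow_two, ← lintegral_mul_const _ hf]
    exact lintegral_congr fun x => (lintegral_const_mul _ hf).symm
  have hm : Measurable fun x => (∫⁻ y, G x y ^ 2 ∂ν) ^ (1 / 2 : ℝ) :=
    ((hG.pow_const 2).lintegral_prod_right').pow_const _
  calc ∫⁻ y, (∫⁻ x, G x y ∂μ) ^ 2 ∂ν
      = ∫⁻ y, ∫⁻ x, ∫⁻ x', G x y * G x' y ∂μ ∂μ ∂ν := lintegral_congr fun y => sq_eq (hx y)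
    _ = ∫⁻ x, ∫⁻ y, ∫⁻ x', G x y * G x' y ∂μ ∂ν ∂μ := by
        refine lintegral_lintegral_swap (Measurable.aemeasurable ?_)
        refine Measurable.lintegral_prod_right'
          (f := fun q : (β × α) × α => G q.1.2 q.1.1 * G q.2 q.1.1) ?_
        exact (hG.comp (by fun_prop : Measurable fun q : (β × α) × α => (q.1.2, q.1.1))).mul
          (hG.comp (by fun_prop : Measurable fun q : (β × α) × α => (q.2, q.1.1)))
    _ = ∫⁻ x, ∫⁻ x', ∫⁻ y, G x y * G x' y ∂ν ∂μ ∂μ := by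
        refine lintegral_congr fun x => lintegral_lintegral_swap (Measurable.aemeasurable ?_)
        exact ((hy x).comp measurable_fst).mul
          (hG.comp (by fun_prop : Measurable fun q : β × α => (q.2, q.1)))
    _ ≤ ∫⁻ x, ∫⁻ x', (∫⁻ y, G x y ^ 2 ∂ν) ^ (1 / 2 : ℝ) * (∫⁻ y, G x' y ^ 2 ∂ν) ^ (1 / 2 : ℝ)
          ∂μ ∂μ := by
        refine lintegral_mono fun x => lintegral_mono fun x' => ?_
        have := ENNReal.lintegral_mul_le_Lp_mul_Lq ν Real.HolderConjugate.two_two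
          (hy x).aemeasurable (hy x').aemeasurable
        simpa using this
    _ = _ := (sq_eq hm).symm

/-- Functions that are polynomials in each variable separately. -/
def SeparatelyPolynomial {ι : Type*} [DecidableEq ι] (F : (ι → ℂ) → ℂ) : Prop :=
  ∀ x i, ∃ f : Polynomial ℂ, ∀ t, F (Function.update x i t) = f.eval t

/-- Induction on the set of variables: one-variable Carleman in the new variable, Minkowski to move
its circle integral outside, then the induction hypothesis on each slice. -/
theorem lmarginal_enorm_rpow_two_mul_le {ι : Type*} [DecidableEq ι] {F : (ι → ℂ) → ℂ}
    (hF : Measurable F) (hpoly : SeparatelyPolynomial F) {p : ℝ} (hp : 0 < p) (S : Finset ι)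
    (x : ι → ℂ) :
    lmarginal (fun _ => diskProb) S (fun z => ‖F z‖ₑ ^ (2 * p)) x
      ≤ (lmarginal (fun _ => circleProb) S (fun z => ‖F z‖ₑ ^ p) x) ^ 2 := by
  induction S using Finset.induction_on generalizing x with
  | empty =>
    rw [lmarginal_empty, lmarginal_empty, mul_comm, ENNReal.rpow_mul]
    norm_num
  | insert i S hi ih =>
    have h2 : Measurable fun z => ‖F z‖ₑ ^ (2 * p) := hF.enorm.pow_const _
    have h1 : Measurable fun z => ‖F z‖ₑ ^ p := hF.enorm.pow_const _
    have hcomm : ∀ t y, Function.update (Function.updateFinset x S y) i t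
        = Function.updateFinset (Function.update x i t) S y := by
      intro t y
      funext j
      by_cases hj : j = i
      · subst hj
        simp [Function.updateFinset, hi]
      · simp [Function.updateFinset, hj]
    have hmeas : Measurable fun q : ℂ × (S → ℂ) =>
        Function.updateFinset (Function.update x i q.1) S q.2 := by
      refine measurable_pi_iff.2 fun j => ?_
      by_cases hj : j ∈ S
      · simp only [Function.updateFinset, hj, dite_true]
        fun_prop
      · simp only [Function.updateFinset, hj, dite_false]
        by_cases hji : j = i
        · subst hji
          simp only [Function.update_self]
          fun_prop
        · simp [Function.update_of_ne hji]
    -- The integral in the new variable is taken innermost on the disk side and outermost on the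
    -- circle side.
    rw [lmarginal_insert' _ h2 hi, lmarginal_insert _ h1 hi]
    calc _ ≤ lmarginal (fun _ => diskProb) S
          (fun z => (∫⁻ t, ‖F (Function.update z i t)‖ₑ ^ p ∂circleProb) ^ 2) x := by
          refine lmarginal_mono (fun z => ?_) x
          obtain ⟨f, hf⟩ := hpoly z i
          simp_rw [hf]
          exact lintegral_enorm_rpow_two_mul_le f hp
      _ ≤ (∫⁻ t, (∫⁻ y, (‖F (Function.updateFinset (Function.update x i t) S y)‖ₑ ^ p) ^ 2
          ∂Measure.pi fun _ : S => diskProb) ^ (1 / 2 : ℝ) ∂circleProb) ^ 2 := by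
          unfold lmarginal
          simp_rw [hcomm]
          exact lintegral_lintegral_sq_le (h1.comp hmeas)
      _ ≤ _ := by
          gcongr with t
          have h3 := ih (Function.update x i t)
          calc _ ≤ ((lmarginal (fun _ => circleProb) S (fun z => ‖F z‖ₑ ^ p)
                (Function.update x i t)) ^ 2) ^ (1 / 2 : ℝ) := by
                gcongr
                refine le_of_eq_of_le ?_ h3
                unfold lmarginal
                refine lintegral_congr fun y => ?_
                rw [← ENNReal.rpow_natCast, ← ENNReal.rpow_mul, mul_comm p]
                norm_num
            _ = _ := by
                rw [← ENNReal.rpow_natCast, ← ENNReal.rpow_mul]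
                norm_num

/-- A function of finitely many coordinates integrates over these alone, which makes the induction
on finite sets available; the base point `x` is immaterial. -/
lemma lintegral_polyMeasure_eq_lmarginal (ν : Measure ℂ) [DiskMeasure ν] {S : Finset Nat.Primes}
    {F : (Nat.Primes → ℂ) → ℝ≥0∞} (hF : Measurable F)
    (hS : ∀ y z : Nat.Primes → ℂ, (∀ q ∈ S, y q = z q) → F y = F z) (x : Nat.Primes → ℂ) :
    ∫⁻ z, F z ∂polyMeasure ν = lmarginal (fun _ => ν) S F x := by
  have h : ∀ z, F z = F (Function.updateFinset x S (S.restrict z)) := fun z =>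
    hS _ _ fun q hq => by simp [Function.updateFinset, hq]
  rw [lintegral_congr h]
  exact lintegral_restrict_infinitePi (μ := fun _ : Nat.Primes => ν) (s := S)
    (f := fun y => F (Function.updateFinset x S y)) (hF.comp measurable_updateFinset)

lemma separatelyPolynomial_bohrMonomial (n : ℕ+) : SeparatelyPolynomial (bohrMonomial n) := by
  intro x i
  unfold bohrMonomial
  induction primeDivisors n using Finset.induction_on with
  | empty => exact ⟨1, fun t => by simp⟩
  | insert q s hq ih =>
    obtain ⟨f, hf⟩ := ih
    by_cases hqi : q = i
    · subst hqi
      exact ⟨Polynomial.X ^ ((n : ℕ).factorization q) * f, fun t => by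
        rw [Finset.prod_insert hq, hf]; simp⟩
    · exact ⟨Polynomial.C (x q ^ ((n : ℕ).factorization q)) * f, fun t => by
        rw [Finset.prod_insert hq, hf]; simp [Function.update_of_ne hqi]⟩

lemma separatelyPolynomial_bohrPoly (P : ℕ+ →₀ ℂ) : SeparatelyPolynomial (bohrPoly P) := by
  intro x i
  choose f hf using fun n => separatelyPolynomial_bohrMonomial n x i
  refine ⟨∑ n ∈ P.support, Polynomial.C (P n) * f n, fun t => ?_⟩
  simp [bohrPoly, Finsupp.sum, Polynomial.eval_finsetSum, hf]

lemma measurable_bohrPoly (P : ℕ+ →₀ ℂ) : Measurable (bohrPoly P) :=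
  Finset.measurable_sum _ fun n _ => (measurable_bohrMonomial n).const_mul (P n)

lemma bohrPoly_congr (P : ℕ+ →₀ ℂ) {y z : Nat.Primes → ℂ}
    (h : ∀ q ∈ P.support.biUnion primeDivisors, y q = z q) : bohrPoly P y = bohrPoly P z := by
  refine Finset.sum_congr rfl fun n hn => ?_
  refine congrArg (P n * ·) (Finset.prod_congr rfl fun q hq => ?_)
  rw [h q (Finset.mem_biUnion.2 ⟨n, hn, hq⟩)]

theorem lintegral_bohrPoly_rpow_two_mul_le (P : ℕ+ →₀ ℂ) {p : ℝ} (hp : 0 < p) :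
    ∫⁻ z, ‖bohrPoly P z‖ₑ ^ (2 * p) ∂polyMeasure diskProb
      ≤ (∫⁻ z, ‖bohrPoly P z‖ₑ ^ p ∂polyMeasure circleProb) ^ 2 := by
  have hm := measurable_bohrPoly P
  rw [lintegral_polyMeasure_eq_lmarginal diskProb (S := P.support.biUnion primeDivisors)
      (hm.enorm.pow_const _) (fun y z h => by rw [bohrPoly_congr P h]) 0,
    lintegral_polyMeasure_eq_lmarginal circleProb (S := P.support.biUnion primeDivisors)
      (hm.enorm.pow_const _) (fun y z h => by rw [bohrPoly_congr P h]) 0]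
  exact lmarginal_enorm_rpow_two_mul_le hm (separatelyPolynomial_bohrPoly P) hp _ 0

theorem eLpNorm_bohrPoly_two_mul_le (P : ℕ+ →₀ ℂ) {p : ℝ≥0∞} (h1 : 1 ≤ p) (hp : p ≠ ∞) :
    eLpNorm (bohrPoly P) (2 * p) (polyMeasure diskProb)
      ≤ eLpNorm (bohrPoly P) p (polyMeasure circleProb) := by
  have hp0 : p ≠ 0 := (zero_lt_one.trans_le h1).ne'
  have hpos : 0 < p.toReal := ENNReal.toReal_pos hp0 hp
  rw [eLpNorm_eq_lintegral_rpow_enorm_toReal (mul_ne_zero two_ne_zero hp0)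
      (ENNReal.mul_ne_top ENNReal.ofNat_ne_top hp),
    eLpNorm_eq_lintegral_rpow_enorm_toReal hp0 hp, ENNReal.toReal_mul, ENNReal.toReal_ofNat]
  refine (ENNReal.rpow_le_rpow (lintegral_bohrPoly_rpow_two_mul_le P hpos)
    (by positivity)).trans_eq ?_
  rw [← ENNReal.rpow_natCast, ← ENNReal.rpow_mul]
  congr 1
  push_cast
  field_simp

lemma norm_bohrLp (ν : Measure ℂ) [DiskMeasure ν] (p : ℝ≥0∞) (P : ℕ+ →₀ ℂ) :
    ‖bohrLp ν p P‖ = (eLpNorm (bohrPoly P) p (polyMeasure ν)).toReal :=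
  Lp.norm_toLp _ (memLp_bohrPoly ν p P)

theorem norm_bohrLp_two_mul_le (P : ℕ+ →₀ ℂ) {p : ℝ≥0∞} (h1 : 1 ≤ p) (hp : p ≠ ∞) :
    ‖bohrLp diskProb (2 * p) P‖ ≤ ‖bohrLp circleProb p P‖ := by
  rw [norm_bohrLp, norm_bohrLp]
  exact ENNReal.toReal_mono (memLp_bohrPoly _ _ P).eLpNorm_ne_top
    (eLpNorm_bohrPoly_two_mul_le P h1 hp)

lemma norm_bohrLp_mono (ν : Measure ℂ) [DiskMeasure ν] (P : ℕ+ →₀ ℂ) {p r : ℝ≥0∞} (h : p ≤ r) :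
    ‖bohrLp ν p P‖ ≤ ‖bohrLp ν r P‖ := by
  rw [norm_bohrLp, norm_bohrLp]
  exact ENNReal.toReal_mono (memLp_bohrPoly _ _ P).eLpNorm_ne_top
    (eLpNorm_le_eLpNorm_of_exponent_le h (measurable_bohrPoly P).aestronglyMeasurable)

/-! ### Orthogonality of the monomials and the coefficients -/

lemma ae_norm_le_one (ν : Measure ℂ) [DiskMeasure ν] (q : Nat.Primes) :
    ∀ᵐ z ∂polyMeasure ν, ‖z q‖ ≤ 1 :=
  (measurePreserving_eval_infinitePi (fun _ : Nat.Primes => ν) q).quasiMeasurePreserving.ae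
    (DiskMeasure.ae_norm_le_one (ν := ν))

lemma ae_coord_ne_zero (ν : Measure ℂ) [RotationInvariant ν] (q : Nat.Primes) :
    ∀ᵐ z ∂polyMeasure ν, z q ≠ 0 :=
  (measurePreserving_eval_infinitePi (fun _ : Nat.Primes => ν) q).quasiMeasurePreserving.ae
    (RotationInvariant.ae_ne_zero (ν := ν))

lemma ae_norm_bohrMonomial_le_one (ν : Measure ℂ) [DiskMeasure ν] (n : ℕ+) :
    ∀ᵐ z ∂polyMeasure ν, ‖bohrMonomial n z‖ ≤ 1 := by
  filter_upwards [ae_all_iff.2 (ae_norm_le_one ν)] with z hz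
  unfold bohrMonomial
  rw [norm_prod]
  refine Finset.prod_le_one (fun _ _ => norm_nonneg _) fun q _ => ?_
  rw [norm_pow]
  exact pow_le_one₀ (norm_nonneg _) (hz q)

/-- A monomial vanishes only where some coordinate does, a null event. This makes the denominator in
`coeff` nonzero. -/
lemma integral_norm_sq_bohrMonomial_pos (ν : Measure ℂ) [RotationInvariant ν] (n : ℕ+) :
    0 < ∫ z, ‖bohrMonomial n z‖ ^ 2 ∂polyMeasure ν := by
  have hint : Integrable (fun z => ‖bohrMonomial n z‖ ^ 2) (polyMeasure ν) :=
    (memLp_bohrMonomial ν 2 n).integrable_norm_pow two_ne_zero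
  have hnn : 0 ≤ᵐ[polyMeasure ν] fun z => ‖bohrMonomial n z‖ ^ 2 :=
    Filter.Eventually.of_forall fun z => by positivity
  refine (integral_nonneg_of_ae hnn).lt_of_ne' fun h => ?_
  rw [integral_eq_zero_iff_of_nonneg_ae hnn hint] at h
  have hfalse : ∀ᵐ _ ∂polyMeasure ν, False := by
    filter_upwards [h, ae_all_iff.2 (ae_coord_ne_zero ν)] with z hz hne
    have : bohrMonomial n z = 0 := by simpa using hz
    obtain ⟨q, -, hq⟩ := Finset.prod_eq_zero_iff.1 this
    exact hne q (eq_zero_of_pow_eq_zero hq)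
  exact absurd hfalse.exists (by simp)

lemma map_mul_polyMeasure (ν : Measure ℂ) [hν : RotationInvariant ν] (w : Nat.Primes → ℂ)
    (hw : ∀ q, ‖w q‖ = 1) : (polyMeasure ν).map (w * ·) = polyMeasure ν := by
  unfold polyMeasure
  have h := Measure.infinitePi_map_pi (μ := fun _ : Nat.Primes => ν)
    (f := fun q => (w q * ·)) fun q => by fun_prop
  refine h.trans ?_
  congr! with q
  exact hν.map_mul _ (hw q)

lemma bohrMonomial_mul (n : ℕ+) (w z : Nat.Primes → ℂ) :
    bohrMonomial n (w * z) = bohrMonomial n w * bohrMonomial n z := by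
  simp only [bohrMonomial, Pi.mul_apply, mul_pow, Finset.prod_mul_distrib]

lemma bohrMonomial_update_one (n : ℕ+) (q : Nat.Primes) (u : ℂ) :
    bohrMonomial n (Function.update 1 q u) = u ^ (n : ℕ).factorization q := by
  unfold bohrMonomial
  rw [Finset.prod_eq_single q]
  · rw [Function.update_self]
  · intro r _ hr
    rw [Function.update_of_ne hr, Pi.one_apply, one_pow]
  · intro hq
    rw [mem_primeDivisors] at hq
    rw [Nat.factorization_eq_zero_of_not_dvd hq, pow_zero]

/-- Distinct integers have different exponents at some prime `q`; rotating the coordinate `q` alone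
multiplies the integral by a factor different from `1`. -/
lemma integral_bohrMonomial_mul_conj (ν : Measure ℂ) [RotationInvariant ν] {n m : ℕ+}
    (h : n ≠ m) : ∫ z, bohrMonomial n z * conj (bohrMonomial m z) ∂polyMeasure ν = 0 := by
  obtain ⟨q, hq⟩ : ∃ q : Nat.Primes, (n : ℕ).factorization q ≠ (m : ℕ).factorization q := by
    by_contra! hc
    refine h (PNat.eq (Nat.eq_of_factorization_eq n.ne_zero m.ne_zero fun q => ?_))
    by_cases hq : q.Prime
    · exact hc ⟨q, hq⟩
    · simp [Nat.factorization_eq_zero_of_not_prime _ hq]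
  obtain ⟨u, hu, hne⟩ := exists_unit_pow_mul_conj_pow_ne_one hq
  set w : Nat.Primes → ℂ := Function.update 1 q u
  have hw : ∀ r, ‖w r‖ = 1 := fun r => by
    by_cases hr : r = q
    · subst hr
      simp [w, hu]
    · simp [w, Function.update_of_ne hr]
  set c := u ^ (n : ℕ).factorization q * conj u ^ (m : ℕ).factorization q
  set I := ∫ z, bohrMonomial n z * conj (bohrMonomial m z) ∂polyMeasure ν with hI
  have hmeas : Measurable fun z => bohrMonomial n z * conj (bohrMonomial m z) :=
    (measurable_bohrMonomial n).mul
      (Complex.continuous_conj.measurable.comp (measurable_bohrMonomial m))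
  have key : I = c * I := by
    conv_lhs => rw [hI, ← map_mul_polyMeasure ν w hw]
    rw [integral_map (by fun_prop) hmeas.aestronglyMeasurable, hI, ← integral_const_mul]
    refine integral_congr_ae (Filter.Eventually.of_forall fun z => ?_)
    simp only [bohrMonomial_mul, w, bohrMonomial_update_one, map_mul, map_pow, c]
    ring
  by_contra h0
  exact hne (mul_right_cancel₀ h0 (by rw [one_mul]; exact key.symm))

lemma integral_bohrPoly_mul_conj (ν : Measure ℂ) [RotationInvariant ν] (P : ℕ+ →₀ ℂ) (n : ℕ+) :
    ∫ z, bohrPoly P z * conj (bohrMonomial n z) ∂polyMeasure ν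
      = P n * (∫ z, ‖bohrMonomial n z‖ ^ 2 ∂polyMeasure ν : ℝ) := by
  have hint : ∀ m, Integrable (fun z => P m * (bohrMonomial m z * conj (bohrMonomial n z)))
      (polyMeasure ν) := fun m =>
    ((memLp_bohrMonomial ν 2 m).integrable_mul (memLp_bohrMonomial ν 2 n).star).const_mul _
  simp_rw [bohrPoly, Finsupp.sum, Finset.sum_mul, mul_assoc]
  rw [integral_finsetSum _ fun m _ => hint m, Finset.sum_eq_single n]
  · rw [integral_const_mul, ← integral_complex_ofReal]
    congr 2
    funext z
    rw [Complex.mul_conj', Complex.ofReal_pow]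
  · intro m _ hm
    rw [integral_const_mul, integral_bohrMonomial_mul_conj ν hm, mul_zero]
  · intro hn
    simp [Finsupp.notMem_support_iff.1 hn]

section DirichletSpace

variable {ν : Measure ℂ} {p : ℝ≥0∞} [Fact (1 ≤ p)]

lemma coeff_ofPoly [RotationInvariant ν] (P : ℕ+ →₀ ℂ) (n : ℕ+) :
    coeff (ofPoly ν p P) n = P n := by
  have h : ∫ z, (ofPoly ν p P : Lp ℂ p (polyMeasure ν)) z * conj (bohrMonomial n z) ∂polyMeasure ν
      = ∫ z, bohrPoly P z * conj (bohrMonomial n z) ∂polyMeasure ν := by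
    refine integral_congr_ae ?_
    filter_upwards [(memLp_bohrPoly ν p P).coeFn_toLp] with z hz
    change (MemLp.toLp (bohrPoly P) (memLp_bohrPoly ν p P)) z * _ = _
    rw [hz]
  rw [coeff, h, integral_bohrPoly_mul_conj, mul_div_assoc, div_self, mul_one]
  exact_mod_cast (integral_norm_sq_bohrMonomial_pos ν n).ne'

lemma integrable_coe [DiskMeasure ν] (f : DirichletSpace ν p) :
    Integrable (f : Lp ℂ p (polyMeasure ν)) (polyMeasure ν) :=
  (Lp.memLp (f : Lp ℂ p (polyMeasure ν))).integrable Fact.out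

lemma integrable_mul_conj_bohrMonomial [DiskMeasure ν] (f : DirichletSpace ν p) (n : ℕ+) :
    Integrable (fun z => (f : Lp ℂ p (polyMeasure ν)) z * conj (bohrMonomial n z))
      (polyMeasure ν) := by
  refine (integrable_coe f).mul_bdd (c := 1) ?_ ?_
  · exact (memLp_bohrMonomial ν 2 n).star.aestronglyMeasurable
  · filter_upwards [ae_norm_bohrMonomial_le_one ν n] with z hz
    simpa using hz

/-- Monomials are bounded by `1` and the `L¹` norm by the `L^p` norm; this is the continuity of the
coefficients. -/
lemma norm_integral_mul_conj_bohrMonomial_le [DiskMeasure ν] (f : DirichletSpace ν p) (n : ℕ+) :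
    ‖∫ z, (f : Lp ℂ p (polyMeasure ν)) z * conj (bohrMonomial n z) ∂polyMeasure ν‖ ≤ ‖f‖ := by
  have h1 : ∫ z, ‖(f : Lp ℂ p (polyMeasure ν)) z‖ ∂polyMeasure ν ≤ ‖f‖ := by
    rw [integral_norm_eq_lintegral_enorm (integrable_coe f).aestronglyMeasurable,
      ← eLpNorm_one_eq_lintegral_enorm]
    change _ ≤ ‖(f : Lp ℂ p (polyMeasure ν))‖
    rw [Lp.norm_def]
    exact ENNReal.toReal_mono (Lp.eLpNorm_ne_top _)
      (eLpNorm_le_eLpNorm_of_exponent_le Fact.out (integrable_coe f).aestronglyMeasurable)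
  refine (norm_integral_le_of_norm_le (integrable_coe f).norm ?_).trans h1
  filter_upwards [ae_norm_bohrMonomial_le_one ν n] with z hz
  rw [norm_mul]
  exact mul_le_of_le_one_right (norm_nonneg _) (by simpa using hz)

/-- The `n`-th coefficient as a bounded linear functional. -/
noncomputable def coeffCLM (ν : Measure ℂ) [DiskMeasure ν] (p : ℝ≥0∞) [Fact (1 ≤ p)] (n : ℕ+) :
    DirichletSpace ν p →L[ℂ] ℂ :=
  LinearMap.mkContinuous
    { toFun := fun f => coeff f n
      map_add' := fun f g => by
        unfold coeff
        rw [← add_div, ← integral_add (integrable_mul_conj_bohrMonomial f n)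
          (integrable_mul_conj_bohrMonomial g n)]
        congr 1
        refine integral_congr_ae ?_
        filter_upwards [Lp.coeFn_add (f : Lp ℂ p (polyMeasure ν)) g] with z hz
        rw [Submodule.coe_add, hz, Pi.add_apply, add_mul]
      map_smul' := fun c f => by
        unfold coeff
        rw [RingHom.id_apply, smul_eq_mul, ← mul_div_assoc, ← integral_const_mul]
        congr 1
        refine integral_congr_ae ?_
        filter_upwards [Lp.coeFn_smul c (f : Lp ℂ p (polyMeasure ν))] with z hz
        rw [Submodule.coe_smul, hz, Pi.smul_apply, smul_eq_mul, mul_assoc] }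
    ‖((∫ z, ‖bohrMonomial n z‖ ^ 2 ∂polyMeasure ν : ℝ) : ℂ)⁻¹‖ fun f => by
      change ‖coeff f n‖ ≤ _
      rw [coeff, div_eq_inv_mul, norm_mul]
      gcongr
      exact norm_integral_mul_conj_bohrMonomial_le f n

/-! ### The identity of Dirichlet series -/

/-- `ofPoly` as a linear map. -/
noncomputable def ofPolyₗ (ν : Measure ℂ) [DiskMeasure ν] (p : ℝ≥0∞) [Fact (1 ≤ p)] :
    (ℕ+ →₀ ℂ) →ₗ[ℂ] DirichletSpace ν p :=
  (bohrLp ν p).codRestrict _ fun P => (ofPoly ν p P).2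

lemma ofPolyₗ_apply [DiskMeasure ν] (P : ℕ+ →₀ ℂ) : ofPolyₗ ν p P = ofPoly ν p P := rfl

lemma norm_ofPoly [DiskMeasure ν] (P : ℕ+ →₀ ℂ) : ‖ofPoly ν p P‖ = ‖bohrLp ν p P‖ := rfl

lemma denseRange_ofPolyₗ [DiskMeasure ν] : DenseRange (ofPolyₗ ν p) := by
  intro f
  rw [closure_subtype]
  have h : (f : Lp ℂ p (polyMeasure ν)) ∈ closure (LinearMap.range (bohrLp ν p) : Set _) := f.2
  convert h using 2
  ext g
  constructor
  · rintro ⟨_, ⟨P, rfl⟩, rfl⟩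
    exact ⟨P, rfl⟩
  · rintro ⟨P, rfl⟩
    exact ⟨_, ⟨P, rfl⟩, rfl⟩

instance [DiskMeasure ν] : CompleteSpace (DirichletSpace ν p) :=
  (Submodule.isClosed_topologicalClosure _).completeSpace_coe

lemma exists_isIdentity {ν₁ ν₂ : Measure ℂ} [RotationInvariant ν₁] [RotationInvariant ν₂]
    {p₁ p₂ : ℝ≥0∞} [Fact (1 ≤ p₁)] [Fact (1 ≤ p₂)]
    (h : ∀ P, ‖bohrLp ν₂ p₂ P‖ ≤ ‖bohrLp ν₁ p₁ P‖) :
    ∃ T : DirichletSpace ν₁ p₁ →L[ℂ] DirichletSpace ν₂ p₂, IsIdentity T ∧ ‖T‖ = 1 := by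
  have hb : ∀ P, ‖ofPolyₗ ν₂ p₂ P‖ ≤ 1 * ‖ofPolyₗ ν₁ p₁ P‖ := fun P => by
    rw [one_mul]
    exact h P
  set T := (ofPolyₗ ν₂ p₂).extendOfNorm (ofPolyₗ ν₁ p₁)
  have hT : ∀ P, T (ofPoly ν₁ p₁ P) = ofPoly ν₂ p₂ P :=
    LinearMap.extendOfNorm_eq (f := ofPolyₗ ν₂ p₂) (e := ofPolyₗ ν₁ p₁) denseRange_ofPolyₗ ⟨1, hb⟩
  refine ⟨T, ⟨hT, fun f n => ?_⟩, le_antisymm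
    (LinearMap.opNorm_extendOfNorm_le (f := ofPolyₗ ν₂ p₂) (e := ofPolyₗ ν₁ p₁)
      denseRange_ofPolyₗ zero_le_one hb) ?_⟩
  · refine denseRange_ofPolyₗ.induction_on (p := fun f => coeff (T f) n = coeff f n) f
      (isClosed_eq ((coeffCLM ν₂ p₂ n).continuous.comp T.continuous)
        (coeffCLM ν₁ p₁ n).continuous) fun P => ?_
    rw [ofPolyₗ_apply, hT, coeff_ofPoly, coeff_ofPoly]
  -- The constant series `1` has norm `1` in every space, so `‖T‖ ≥ 1`.
  · have hone : ∀ (ν : Measure ℂ) [DiskMeasure ν] (p : ℝ≥0∞) [Fact (1 ≤ p)],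
        ‖ofPoly ν p (Finsupp.single 1 1)‖ = 1 := by
      intro ν _ p hp
      have h1 : bohrPoly (Finsupp.single 1 1) = fun _ => (1 : ℂ) := by
        funext z
        simp [bohrPoly, bohrMonomial, Nat.factorization_one]
      rw [norm_ofPoly, norm_bohrLp, h1, eLpNorm_const _ (zero_lt_one.trans_le hp.out).ne'
        (IsProbabilityMeasure.ne_zero _)]
      simp
    have := T.le_opNorm (ofPoly ν₁ p₁ (Finsupp.single 1 1))
    rwa [hT, hone, hone, mul_one] at this

end DirichletSpace

/-! ### Khintchine's inequality for Dirichlet polynomials over the primes -/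

/-- A prime number as a positive integer. -/
def primePNat (q : Nat.Primes) : ℕ+ := ⟨q, q.2.pos⟩

lemma primePNat_injective : Function.Injective primePNat := fun _ _ h =>
  Subtype.ext (congrArg PNat.val h)

lemma bohrMonomial_primePNat (q : Nat.Primes) (z : Nat.Primes → ℂ) :
    bohrMonomial (primePNat q) z = z q := by
  unfold bohrMonomial
  rw [Finset.prod_eq_single q]
  · simp [primePNat, q.2.factorization_self]
  · intro r hr hrq
    exact absurd (Subtype.ext ((Nat.prime_dvd_prime_iff_eq r.2 q.2).1 (mem_primeDivisors.1 hr))) hrq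
  · intro h
    exact absurd (mem_primeDivisors.2 (dvd_refl _)) h

/-- The Dirichlet polynomial `∑ a_q q^{-s}` over the primes. -/
noncomputable def primePoly : (Nat.Primes →₀ ℂ) →ₗ[ℂ] (ℕ+ →₀ ℂ) :=
  Finsupp.lmapDomain ℂ ℂ primePNat

lemma bohrPoly_primePoly (a : Nat.Primes →₀ ℂ) (z : Nat.Primes → ℂ) :
    bohrPoly (primePoly a) z = ∑ q ∈ a.support, a q * z q := by
  rw [bohrPoly, primePoly, Finsupp.lmapDomain_apply,
    Finsupp.sum_mapDomain_index (fun _ => zero_mul _) fun _ _ _ => add_mul _ _ _]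
  simp only [bohrMonomial_primePNat]
  rfl

lemma integral_coord (ν : Measure ℂ) [DiskMeasure ν] (q : Nat.Primes) {E : Type*}
    [NormedAddCommGroup E] [NormedSpace ℝ E] {f : ℂ → E} (hf : Continuous f) :
    ∫ z, f (z q) ∂polyMeasure ν = ∫ w, f w ∂ν := by
  have h := measurePreserving_eval_infinitePi (fun _ : Nat.Primes => ν) q
  conv_rhs => rw [← h.map_eq]
  rw [integral_map h.measurable.aemeasurable hf.aestronglyMeasurable]
  rfl

/-- Hoeffding's lemma for a centred variable in `[-‖c‖, ‖c‖]`: the variance proxy is the square of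
half the length. -/
lemma hasSubgaussianMGF_re_mul (ν : Measure ℂ) [RotationInvariant ν] (q : Nat.Primes) (c : ℂ) :
    ProbabilityTheory.HasSubgaussianMGF (fun z : Nat.Primes → ℂ => (c * z q).re) (‖c‖₊ ^ 2)
      (polyMeasure ν) := by
  have h := ProbabilityTheory.hasSubgaussianMGF_of_mem_Icc_of_integral_eq_zero
    (X := fun z : Nat.Primes → ℂ => (c * z q).re) (μ := polyMeasure ν) (a := -‖c‖) (b := ‖c‖)
    (by fun_prop) ?_ ?_
  · convert h using 2
    ext
    simp only [coe_nnnorm, NNReal.coe_div, sub_neg_eq_add, NNReal.coe_ofNat]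
    rw [Real.norm_of_nonneg (by positivity)]
    ring
  · filter_upwards [ae_norm_le_one ν q] with z hz
    have h1 : |(c * z q).re| ≤ ‖c‖ := (Complex.abs_re_le_norm _).trans (by
      rw [norm_mul]
      exact mul_le_of_le_one_right (norm_nonneg _) hz)
    exact abs_le.1 h1
  · rw [integral_coord ν q (f := fun w => (c * w).re) (by fun_prop)]
    have hi : Integrable (fun w : ℂ => c * w) ν := integrable_of_continuous ν (by fun_prop)
    have h0 : ∫ w : ℂ, w ∂ν = 0 := by
      simpa using integral_pow_mul_conj_pow ν one_ne_zero
    have h2 := integral_re hi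
    rw [integral_const_mul, h0, mul_zero] at h2
    simpa using h2

/-- A finitely supported family as an element of `ℓ²`. -/
noncomputable def toEll2 : (Nat.Primes →₀ ℂ) →ₗ[ℂ] lp (fun _ : Nat.Primes => ℂ) 2 :=
  Finsupp.lsum ℂ fun q => lp.lsingle (𝕜 := ℂ) (E := fun _ : Nat.Primes => ℂ) 2 q

lemma toEll2_eq_sum (a : Nat.Primes →₀ ℂ) :
    toEll2 a = ∑ q ∈ a.support, lp.single 2 q (a q) := rfl

lemma toEll2_apply (a : Nat.Primes →₀ ℂ) (q : Nat.Primes) : toEll2 a q = a q := by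
  rw [toEll2_eq_sum, lp.coeFn_sum, Finset.sum_apply]
  simp only [lp.coeFn_single]
  rw [Finset.sum_pi_single]
  by_cases hq : a q = 0 <;> simp [hq]

lemma sq_norm_toEll2 (a : Nat.Primes →₀ ℂ) : ‖toEll2 a‖ ^ 2 = ∑ q ∈ a.support, ‖a q‖ ^ 2 := by
  have := lp.norm_sum_single (E := fun _ : Nat.Primes => ℂ) (p := 2) (by norm_num) a a.support
  rw [toEll2_eq_sum]
  simpa using this

lemma denseRange_toEll2 : DenseRange toEll2 := by
  intro a
  refine mem_closure_of_tendsto (lp.hasSum_single (by norm_num) a)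
    (Filter.Eventually.of_forall fun s => ?_)
  exact ⟨∑ q ∈ s, Finsupp.single q (a q), by simp [toEll2, map_sum]⟩

/-- Variance proxies of independent variables add up. The unimodular `u` gives access to the real
part in every direction. -/
lemma hasSubgaussianMGF_re_mul_bohrPoly (ν : Measure ℂ) [RotationInvariant ν]
    (a : Nat.Primes →₀ ℂ) {u : ℂ} (hu : ‖u‖ = 1) :
    ProbabilityTheory.HasSubgaussianMGF (fun z => (u * bohrPoly (primePoly a) z).re)
      (∑ q ∈ a.support, ‖a q‖₊ ^ 2) (polyMeasure ν) := by
  have hind : ProbabilityTheory.iIndepFun (fun q (z : Nat.Primes → ℂ) => (u * a q * z q).re)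
      (polyMeasure ν) :=
    ProbabilityTheory.iIndepFun_infinitePi (P := fun _ : Nat.Primes => ν)
      (X := fun q w => (u * a q * w).re) fun q => by fun_prop
  have h := ProbabilityTheory.HasSubgaussianMGF.sum_of_iIndepFun hind (s := a.support)
    (c := fun q => ‖u * a q‖₊ ^ 2) fun q _ => hasSubgaussianMGF_re_mul ν q _
  have hu' : ‖u‖₊ = 1 := by
    ext
    exact hu
  convert h using 2
  · rw [bohrPoly_primePoly, Finset.mul_sum, Complex.re_sum]
    simp only [mul_assoc]
  · rw [nnnorm_mul, hu', one_mul]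

lemma integral_exp_re_mul_bohrPoly_le (ν : Measure ℂ) [RotationInvariant ν]
    (a : Nat.Primes →₀ ℂ) {u : ℂ} (hu : ‖u‖ = 1) (t : ℝ) :
    Integrable (fun z => Real.exp (t * (u * bohrPoly (primePoly a) z).re)) (polyMeasure ν) ∧
    ∫ z, Real.exp (t * (u * bohrPoly (primePoly a) z).re) ∂polyMeasure ν
      ≤ Real.exp (‖toEll2 a‖ ^ 2 * t ^ 2 / 2) := by
  have h := hasSubgaussianMGF_re_mul_bohrPoly ν a hu
  refine ⟨h.integrable_exp_mul t, (h.mgf_le t).trans_eq ?_⟩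
  rw [sq_norm_toEll2]
  push_cast
  rfl

/-- `‖w‖^k / k! ≤ exp ‖w‖`, and `‖w‖` is at most twice the larger of `|Re w|` and `|Im w|`; the four
units `±1, ±I` account for the signs. -/
lemma pow_norm_le_factorial_mul_exp (w : ℂ) (k : ℕ) :
    ‖w‖ ^ k ≤ k.factorial * (Real.exp (2 * (1 * w).re) + Real.exp (2 * (-1 * w).re)
      + Real.exp (2 * (Complex.I * w).re) + Real.exp (2 * (-Complex.I * w).re)) := by
  have h1 : ‖w‖ ^ k ≤ k.factorial * Real.exp ‖w‖ := by
    have := Real.pow_div_factorial_le_exp ‖w‖ (norm_nonneg _) k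
    rwa [div_le_iff₀ (by positivity), mul_comm] at this
  refine h1.trans (mul_le_mul_of_nonneg_left ?_ (by positivity))
  have h2 := Complex.norm_le_abs_re_add_abs_im w
  have h3 : Real.exp ‖w‖ ≤ Real.exp (2 * |w.re|) + Real.exp (2 * |w.im|) := by
    rcases le_total |w.re| |w.im| with h | h
    · have := Real.exp_le_exp.2 (show ‖w‖ ≤ 2 * |w.im| by linarith)
      have := Real.exp_pos (2 * |w.re|)
      linarith
    · have := Real.exp_le_exp.2 (show ‖w‖ ≤ 2 * |w.re| by linarith)
      have := Real.exp_pos (2 * |w.im|)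
      linarith
  have h4 : ∀ x : ℝ, Real.exp (2 * |x|) ≤ Real.exp (2 * x) + Real.exp (2 * -x) := by
    intro x
    have e1 := Real.exp_pos (2 * x)
    have e2 := Real.exp_pos (2 * -x)
    rcases abs_choice x with h | h <;> rw [h] <;> linarith
  have h5 := h4 w.re
  have h6 := h4 w.im
  simp only [neg_mul, one_mul, Complex.neg_re, Complex.I_mul_re, neg_neg]
  linarith

lemma toEll2_injective : Function.Injective toEll2 := fun a b h => by
  ext q
  rw [← toEll2_apply, h, toEll2_apply]

lemma integrable_norm_bohrPoly_pow (ν : Measure ℂ) [DiskMeasure ν] (P : ℕ+ →₀ ℂ) (k : ℕ) :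
    Integrable (fun z => ‖bohrPoly P z‖ ^ k) (polyMeasure ν) :=
  (memLp_bohrPoly ν k P).integrable_norm_pow'

/-- The constant in the moment bound for Dirichlet polynomials over the primes. -/
noncomputable def momentConst (k : ℕ) : ℝ := k.factorial * (4 * Real.exp 2)

lemma momentConst_pos (k : ℕ) : 0 < momentConst k := by
  unfold momentConst
  positivity

lemma bohrPoly_smul (c : ℂ) (P : ℕ+ →₀ ℂ) (z : Nat.Primes → ℂ) :
    bohrPoly (c • P) z = c * bohrPoly P z := by
  rw [bohrPoly, bohrPoly, Finsupp.sum_smul_index fun _ => zero_mul _, Finsupp.mul_sum]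
  simp only [mul_assoc]

theorem integral_norm_bohrPoly_primePoly_pow_le (ν : Measure ℂ) [RotationInvariant ν]
    (a : Nat.Primes →₀ ℂ) {k : ℕ} (hk : k ≠ 0) :
    ∫ z, ‖bohrPoly (primePoly a) z‖ ^ k ∂polyMeasure ν ≤ momentConst k * ‖toEll2 a‖ ^ k := by
  have hunit : ∀ b : Nat.Primes →₀ ℂ, ‖toEll2 b‖ = 1 →
      ∫ z, ‖bohrPoly (primePoly b) z‖ ^ k ∂polyMeasure ν ≤ momentConst k := by
    intro b hb
    -- At `t = 2` and unit norm each of the four exponential moments is at most `exp (2² / 2)`,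
    -- whence `4 e²` in `momentConst`.
    have he : ∀ {u : ℂ}, ‖u‖ = 1 → _ := fun {u} hu => integral_exp_re_mul_bohrPoly_le ν b (u := u) hu 2
    have e1 := he (u := 1) (by simp)
    have e2 := he (u := -1) (by simp)
    have e3 := he (u := Complex.I) (by simp)
    have e4 := he (u := -Complex.I) (by simp)
    rw [hb] at e1 e2 e3 e4
    norm_num only at e1 e2 e3 e4
    refine (integral_mono (integrable_norm_bohrPoly_pow ν _ k)
      ((((e1.1.add e2.1).add e3.1).add e4.1).const_mul _) fun z =>
        pow_norm_le_factorial_mul_exp (bohrPoly (primePoly b) z) k).trans ?_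
    simp only [Pi.add_apply]
    have hadd : ∀ {f g : (Nat.Primes → ℂ) → ℝ}, Integrable f (polyMeasure ν) →
        Integrable g (polyMeasure ν) → ∫ z, f z + g z ∂polyMeasure ν
          = ∫ z, f z ∂polyMeasure ν + ∫ z, g z ∂polyMeasure ν := fun hf hg => integral_add hf hg
    have e12 := e1.1.add e2.1
    have e123 := e12.add e3.1
    simp only [Pi.add_def] at e12 e123
    rw [integral_const_mul, hadd e123 e4.1, hadd e12 e3.1, hadd e1.1 e2.1, momentConst]
    gcongr
    linarith [e1.2, e2.2, e3.2, e4.2]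
  rcases (norm_nonneg (toEll2 a)).eq_or_lt with h0 | h0
  · have ha : a = 0 := toEll2_injective (by rw [map_zero, ← norm_eq_zero, ← h0])
    simp [ha, bohrPoly, hk]
  -- The general case follows by homogeneity.
  · have h := hunit (((‖toEll2 a‖⁻¹ : ℝ) : ℂ) • a) (by
      rw [map_smul, norm_smul, Complex.norm_real, norm_inv, norm_norm, inv_mul_cancel₀ h0.ne'])
    simp_rw [map_smul, bohrPoly_smul, norm_mul, mul_pow, Complex.norm_real, norm_inv, norm_norm]
      at h
    rw [integral_const_mul, inv_pow, inv_mul_le_iff₀ (by positivity), mul_comm] at h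
    exact h

lemma integral_norm_sq_bohrPoly (ν : Measure ℂ) [RotationInvariant ν] (P : ℕ+ →₀ ℂ) :
    ∫ z, ‖bohrPoly P z‖ ^ 2 ∂polyMeasure ν
      = ∑ n ∈ P.support, ‖P n‖ ^ 2 * ∫ z, ‖bohrMonomial n z‖ ^ 2 ∂polyMeasure ν := by
  apply Complex.ofReal_injective
  have hint : ∀ n, Integrable (fun z => conj (P n) * (bohrPoly P z * conj (bohrMonomial n z)))
      (polyMeasure ν) := fun n =>
    ((memLp_bohrPoly ν 2 P).integrable_mul (memLp_bohrMonomial ν 2 n).star).const_mul _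
  have h : ∀ z, ((‖bohrPoly P z‖ ^ 2 : ℝ) : ℂ)
      = ∑ n ∈ P.support, conj (P n) * (bohrPoly P z * conj (bohrMonomial n z)) := by
    intro z
    have hconj : conj (bohrPoly P z) = ∑ n ∈ P.support, conj (P n) * conj (bohrMonomial n z) := by
      rw [bohrPoly, Finsupp.sum, map_sum]
      simp only [map_mul]
    rw [Complex.ofReal_pow, ← Complex.mul_conj', hconj, Finset.mul_sum]
    exact Finset.sum_congr rfl fun n _ => by ring
  rw [← integral_complex_ofReal]
  simp_rw [h]
  rw [integral_finsetSum _ fun n _ => hint n, Complex.ofReal_sum]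
  refine Finset.sum_congr rfl fun n _ => ?_
  rw [integral_const_mul, integral_bohrPoly_mul_conj, ← mul_assoc, Complex.conj_mul',
    Complex.ofReal_mul, Complex.ofReal_pow]

/-- The second moment of the modulus. -/
noncomputable def secondMoment (ν : Measure ℂ) : ℝ := ∫ w, ‖w‖ ^ 2 ∂ν

lemma integral_norm_sq_bohrMonomial_primePNat (ν : Measure ℂ) [DiskMeasure ν] (q : Nat.Primes) :
    ∫ z, ‖bohrMonomial (primePNat q) z‖ ^ 2 ∂polyMeasure ν = secondMoment ν := by
  simp_rw [bohrMonomial_primePNat]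
  exact integral_coord ν q (f := fun w => ‖w‖ ^ 2) (by fun_prop)

lemma secondMoment_pos (ν : Measure ℂ) [RotationInvariant ν] : 0 < secondMoment ν := by
  rw [← integral_norm_sq_bohrMonomial_primePNat ν ⟨2, Nat.prime_two⟩]
  exact integral_norm_sq_bohrMonomial_pos ν _

lemma integral_norm_sq_bohrPoly_primePoly (ν : Measure ℂ) [RotationInvariant ν]
    (a : Nat.Primes →₀ ℂ) :
    ∫ z, ‖bohrPoly (primePoly a) z‖ ^ 2 ∂polyMeasure ν = secondMoment ν * ‖toEll2 a‖ ^ 2 := by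
  rw [integral_norm_sq_bohrPoly, sq_norm_toEll2, primePoly, Finsupp.lmapDomain_apply,
    Finsupp.mapDomain_support_of_injective primePNat_injective,
    Finset.sum_image primePNat_injective.injOn, Finset.mul_sum]
  refine Finset.sum_congr rfl fun q _ => ?_
  rw [integral_norm_sq_bohrMonomial_primePNat, Finsupp.mapDomain_apply primePNat_injective,
    mul_comm]

lemma norm_bohrLp_pow (ν : Measure ℂ) [DiskMeasure ν] (P : ℕ+ →₀ ℂ) {k : ℕ} (hk : k ≠ 0) :
    ‖bohrLp ν k P‖ ^ k = ∫ z, ‖bohrPoly P z‖ ^ k ∂polyMeasure ν := by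
  rw [norm_bohrLp, (memLp_bohrPoly ν k P).eLpNorm_eq_integral_rpow_norm
    (by exact_mod_cast hk) (ENNReal.natCast_ne_top k), ENNReal.toReal_ofReal (by positivity)]
  simp only [ENNReal.toReal_natCast, Real.rpow_natCast]
  exact Real.rpow_inv_natCast_pow (integral_nonneg fun z => by positivity) hk

/-- Split at `x = l`. Integrated, it bounds the second moment by the first and the fourth. -/
lemma sq_le_mul_add_pow_four_div {x l : ℝ} (hx : 0 ≤ x) (hl : 0 < l) :
    x ^ 2 ≤ l * x + x ^ 4 / l ^ 2 := by
  rcases le_total x l with h | h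
  · have : 0 ≤ x ^ 4 / l ^ 2 := by positivity
    nlinarith
  · have h1 : x ^ 2 ≤ x ^ 4 / l ^ 2 := by
      rw [le_div_iff₀ (by positivity)]
      calc x ^ 2 * l ^ 2 ≤ x ^ 2 * x ^ 2 := by gcongr
        _ = x ^ 4 := by ring
    have : 0 ≤ l * x := by positivity
    linarith

lemma exists_le_norm_bohrLp_one (ν : Measure ℂ) [RotationInvariant ν] :
    ∃ c : ℝ, 0 < c ∧ ∀ a, c * ‖toEll2 a‖ ≤ ‖bohrLp ν 1 (primePoly a)‖ := by
  have hm := secondMoment_pos ν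
  have hK := momentConst_pos 4
  set m := secondMoment ν
  -- `M` makes the fourth-moment term at threshold `M * N` at most half of the second moment `m *
  -- N²`; the other half is left to the first moment.
  set M := Real.sqrt (2 * momentConst 4 / m)
  have hM : 0 < M := Real.sqrt_pos.2 (by positivity)
  have hM2 : M ^ 2 = 2 * momentConst 4 / m := Real.sq_sqrt (by positivity)
  refine ⟨m / (2 * M), by positivity, fun a => ?_⟩
  rcases (norm_nonneg (toEll2 a)).eq_or_lt with h0 | h0
  · rw [← h0, mul_zero]
    exact norm_nonneg _
  have h1 : ‖bohrLp ν 1 (primePoly a)‖ = ∫ z, ‖bohrPoly (primePoly a) z‖ ∂polyMeasure ν := by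
    rw [norm_bohrLp, eLpNorm_one_eq_lintegral_enorm, integral_norm_eq_lintegral_enorm
      (measurable_bohrPoly _).aestronglyMeasurable]
  have hi := fun k => integrable_norm_bohrPoly_pow ν (primePoly a) k
  have hi1 : Integrable (fun z => ‖bohrPoly (primePoly a) z‖) (polyMeasure ν) := by
    simpa using hi 1
  have h2 := integral_norm_sq_bohrPoly_primePoly ν a
  have h4 := integral_norm_bohrPoly_primePoly_pow_le ν a (k := 4) (by norm_num)
  set N := ‖toEll2 a‖
  change _ = m * N ^ 2 at h2
  have hl : 0 < M * N := by positivity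
  have key : ∫ z, ‖bohrPoly (primePoly a) z‖ ^ 2 ∂polyMeasure ν
      ≤ M * N * (∫ z, ‖bohrPoly (primePoly a) z‖ ∂polyMeasure ν)
        + (∫ z, ‖bohrPoly (primePoly a) z‖ ^ 4 ∂polyMeasure ν) / (M * N) ^ 2 := by
    rw [← integral_const_mul, ← integral_div, ← integral_add (hi1.const_mul _) ((hi 4).div_const _)]
    exact integral_mono (hi 2) ((hi1.const_mul _).add ((hi 4).div_const _)) fun z =>
      sq_le_mul_add_pow_four_div (norm_nonneg _) hl
  rw [← h1, h2] at key
  have h5 : (∫ z, ‖bohrPoly (primePoly a) z‖ ^ 4 ∂polyMeasure ν) / (M * N) ^ 2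
      ≤ m * N ^ 2 / 2 := by
    rw [div_le_iff₀ (by positivity), mul_pow, hM2]
    refine h4.trans_eq ?_
    field_simp
  rw [div_mul_eq_mul_div, div_le_iff₀ (by positivity)]
  refine le_of_mul_le_mul_right ?_ h0
  nlinarith

/-- Khintchine's inequality. -/
theorem exists_norm_bohrLp_primePoly_equiv (ν : Measure ℂ) [RotationInvariant ν] {p : ℝ≥0∞}
    (h1 : 1 ≤ p) (hp : p ≠ ∞) :
    ∃ c C : ℝ, 0 < c ∧ ∀ a, c * ‖toEll2 a‖ ≤ ‖bohrLp ν p (primePoly a)‖ ∧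
      ‖bohrLp ν p (primePoly a)‖ ≤ C * ‖toEll2 a‖ := by
  obtain ⟨c, hc, hlow⟩ := exists_le_norm_bohrLp_one ν
  -- On a probability space the `L^p` norm lies between the `L¹` and `L^k` norms, which are already
  -- controlled.
  obtain ⟨k, hk⟩ := ENNReal.exists_nat_gt hp
  have hk0 : k ≠ 0 := by
    rintro rfl
    simp at hk
  have hK := (momentConst_pos k).le
  refine ⟨c, momentConst k ^ ((k : ℝ)⁻¹), hc, fun a =>
    ⟨(hlow a).trans (norm_bohrLp_mono ν _ h1), (norm_bohrLp_mono ν _ hk.le).trans ?_⟩⟩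
  refine le_of_pow_le_pow_left₀ hk0 (by positivity) ?_
  rw [norm_bohrLp_pow ν _ hk0, mul_pow, Real.rpow_inv_natCast_pow hK hk0]
  exact integral_norm_bohrPoly_primePoly_pow_le ν a hk0

/-! ### The closed span of the primes -/

section PrimeSpan

variable {ν : Measure ℂ} [RotationInvariant ν] {p : ℝ≥0∞} [Fact (1 ≤ p)]

/-- The Dirichlet series `∑ a_q q^{-s}` of a square summable family. -/
noncomputable def primeSeries (ν : Measure ℂ) [DiskMeasure ν] (p : ℝ≥0∞) [Fact (1 ≤ p)] :
    lp (fun _ : Nat.Primes => ℂ) 2 →L[ℂ] DirichletSpace ν p :=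
  (ofPolyₗ ν p ∘ₗ primePoly).extendOfNorm toEll2

/-- The definition of `primeSeries` carries no bound; the upper Khintchine estimate is what makes it
a genuine extension. -/
lemma primeSeries_toEll2 (hp : p ≠ ∞) (a : Nat.Primes →₀ ℂ) :
    primeSeries ν p (toEll2 a) = ofPoly ν p (primePoly a) := by
  obtain ⟨_, C, -, h⟩ := exists_norm_bohrLp_primePoly_equiv ν (p := p) Fact.out hp
  exact LinearMap.extendOfNorm_eq (f := ofPolyₗ ν p ∘ₗ primePoly) (e := toEll2)
    denseRange_toEll2 ⟨C, fun a => (h a).2⟩ a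

lemma exists_mul_norm_le_norm_primeSeries (ν : Measure ℂ) [RotationInvariant ν] (hp : p ≠ ∞) :
    ∃ c : ℝ, 0 < c ∧ ∀ a, c * ‖a‖ ≤ ‖primeSeries ν p a‖ := by
  obtain ⟨c, _, hc, h⟩ := exists_norm_bohrLp_primePoly_equiv ν (p := p) Fact.out hp
  refine ⟨c, hc, fun a => denseRange_toEll2.induction_on
    (p := fun a => c * ‖a‖ ≤ ‖primeSeries ν p a‖) a
    (isClosed_le (by fun_prop) (by fun_prop)) fun b => ?_⟩
  rw [primeSeries_toEll2 hp]
  exact (h b).1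

lemma coeff_primeSeries (hp : p ≠ ∞) (a : lp (fun _ : Nat.Primes => ℂ) 2) (n : ℕ+) :
    coeff (primeSeries ν p a) n = if h : Nat.Prime n then a ⟨n, h⟩ else 0 := by
  refine denseRange_toEll2.induction_on
    (p := fun a => coeff (primeSeries ν p a) n = if h : Nat.Prime n then a ⟨n, h⟩ else 0) a
    (isClosed_eq ((coeffCLM ν p n).continuous.comp (primeSeries ν p).continuous) ?_) fun b => ?_
  · split_ifs with h
    · exact (continuous_apply _).comp lp.uniformContinuous_coe.continuous
    · exact continuous_const
  · rw [primeSeries_toEll2 hp, coeff_ofPoly, primePoly, Finsupp.lmapDomain_apply]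
    split_ifs with h
    · exact (Finsupp.mapDomain_apply primePNat_injective b ⟨n, h⟩).trans
        (toEll2_apply b ⟨n, h⟩).symm
    · refine Finsupp.mapDomain_of_notMem_range _ _ ?_
      rintro ⟨q, rfl⟩
      exact h q.2

/-- Density of finite families puts the range inside the closed span; closedness of the range gives
the converse, since it contains every generator. -/
lemma range_primeSeries (ν : Measure ℂ) [RotationInvariant ν] (hp : p ≠ ∞)
    (hcl : IsClosed (Set.range (primeSeries ν p))) :
    LinearMap.range (primeSeries ν p).toLinearMap = primeSpan ν p := by
  refine le_antisymm ?_ (Submodule.topologicalClosure_minimal _ (Submodule.span_le.2 ?_) hcl)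
  · rintro _ ⟨a, rfl⟩
    refine denseRange_toEll2.induction_on (p := fun a => primeSeries ν p a ∈ primeSpan ν p) a
      ((Submodule.isClosed_topologicalClosure _).preimage (primeSeries ν p).continuous) fun b => ?_
    rw [primeSeries_toEll2 hp, ← ofPolyₗ_apply, ← LinearMap.comp_apply]
    induction b using Finsupp.induction_linear with
    | zero => simp
    | add f g hf hg =>
      rw [map_add]
      exact add_mem hf hg
    | single q c =>
      rw [← mul_one c, ← smul_eq_mul, ← Finsupp.smul_single, map_smul]
      refine Submodule.smul_mem _ _ (Submodule.le_topologicalClosure _ (Submodule.subset_span ?_))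
      refine ⟨primePNat q, q.2, ?_⟩
      rw [LinearMap.comp_apply, primePoly, Finsupp.lmapDomain_apply, Finsupp.mapDomain_single]
      rfl
  · rintro _ ⟨n, hn, rfl⟩
    refine ⟨toEll2 (Finsupp.single ⟨n, hn⟩ 1), ?_⟩
    exact (primeSeries_toEll2 hp _).trans (congrArg (ofPoly ν p) Finsupp.mapDomain_single)

/-- The lower Khintchine bound makes `primeSeries` injective with closed range, hence an isomorphism
onto the span. -/
lemma exists_equiv_primeSpan (ν : Measure ℂ) [RotationInvariant ν] (hp : p ≠ ∞) :
    ∃ Φ : lp (fun _ : Nat.Primes => ℂ) 2 ≃L[ℂ] primeSpan ν p,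
      ∀ a, (Φ a : DirichletSpace ν p) = primeSeries ν p a := by
  obtain ⟨c, hc, h⟩ := exists_mul_norm_le_norm_primeSeries (p := p) ν hp
  have hanti : AntilipschitzWith (Real.toNNReal c⁻¹) (primeSeries ν p) :=
    AddMonoidHomClass.antilipschitz_of_bound _ fun a => by
      rw [Real.coe_toNNReal _ (inv_pos.2 hc).le, inv_mul_eq_div, le_div_iff₀ hc, mul_comm]
      exact h a
  have hcl := hanti.isClosed_range (primeSeries ν p).uniformContinuous
  exact ⟨(ContinuousLinearMap.equivRange hanti.injective hcl).trans
    (ContinuousLinearEquiv.ofEq _ _ (range_primeSeries ν hp hcl)), fun a => rfl⟩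

end PrimeSpan

lemma not_finiteDimensional_ell2 :
    ¬ FiniteDimensional ℂ (lp (fun _ : Nat.Primes => ℂ) 2) := fun _ =>
  Module.Finite.not_linearIndependent_of_infinite (R := ℂ)
    (fun q : Nat.Primes => toEll2 (Finsupp.single q 1))
    ((Finsupp.linearIndependent_single_one ℂ Nat.Primes).map' toEll2
      (LinearMap.ker_eq_bot.2 toEll2_injective))

end DirichletBergman

/-! ### The main theorem -/

open DirichletBergman in
theorem mainTheorem5 (p : ℝ≥0∞) [Fact (1 ≤ p)] (hp : p ≠ ∞) :
    (∃ T : Hardy p →L[ℂ] Bergman (2 * p), IsIdentity T ∧ ‖T‖ = 1) ∧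
    (∃ T : Hardy p →L[ℂ] Bergman p, IsIdentity T ∧
      ¬ IsCompactOperator T ∧
      ¬ StrictlySingular T ∧
      ∃ (Φ : lp (fun _ : Nat.Primes => ℂ) 2 ≃L[ℂ] primeSpan circleProb p)
        (Ψ : lp (fun _ : Nat.Primes => ℂ) 2 ≃L[ℂ] primeSpan diskProb p),
        SendsToSeries Φ ∧ SendsToSeries Ψ ∧
          ∀ a, T (Φ a : Hardy p) = (Ψ a : Bergman p)) := by
  have h1 : 1 ≤ p := Fact.out
  have hcontr : ∀ P, ‖bohrLp diskProb (2 * p) P‖ ≤ ‖bohrLp circleProb p P‖ := fun P =>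
    norm_bohrLp_two_mul_le P h1 hp
  refine ⟨exists_isIdentity hcontr, ?_⟩
  obtain ⟨T, hT, -⟩ := exists_isIdentity (ν₁ := circleProb) (ν₂ := diskProb) (p₁ := p) (p₂ := p)
    fun P => (norm_bohrLp_mono diskProb P (le_mul_of_one_le_left zero_le one_le_two)).trans
      (hcontr P)
  obtain ⟨Φ, hΦ⟩ := exists_equiv_primeSpan (p := p) circleProb hp
  obtain ⟨Ψ, hΨ⟩ := exists_equiv_primeSpan (p := p) diskProb hp
  have hTΦ : ∀ a, T (Φ a : Hardy p) = (Ψ a : Bergman p) := by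
    intro a
    rw [hΦ, hΨ]
    refine denseRange_toEll2.induction_on
      (p := fun a => T (primeSeries circleProb p a) = primeSeries diskProb p a) a
      (isClosed_eq (by fun_prop) (by fun_prop)) fun b => ?_
    rw [primeSeries_toEll2 hp, primeSeries_toEll2 hp, hT.map_ofPoly]
  refine ⟨T, hT, fun hcomp => ?_, fun hss => ?_, Φ, Ψ, fun a n => ?_, fun a n => ?_, hTΦ⟩
  -- If `T` were compact, so would be `Ψ⁻¹ ∘ T ∘ Φ`, the identity of `ℓ²`.
  · have hc1 : IsCompactOperator (T ∘ ((primeSpan circleProb p).subtypeL.comp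
        (Φ : lp (fun _ : Nat.Primes => ℂ) 2 →L[ℂ] primeSpan circleProb p))) := hcomp.comp_clm _
    have hc2 := hc1.codRestrict (V := primeSpan diskProb p)
      (fun a => by
        change T (Φ a : Hardy p) ∈ _
        rw [hTΦ]
        exact (Ψ a).2) (Submodule.isClosed_topologicalClosure _)
    have hc3 := hc2.clm_comp
      (Ψ.symm : primeSpan diskProb p →L[ℂ] lp (fun _ : Nat.Primes => ℂ) 2)
    refine not_finiteDimensional_ell2 ((isCompactOperator_id_iff_finiteDimensional (𝕜 := ℂ)).1 ?_)
    convert hc3 using 1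
    · rfl
    · funext a
      refine (Ψ.symm_apply_apply a).symm.trans (congrArg Ψ.symm (Subtype.ext ?_))
      exact (hTΦ a).symm
  · obtain ⟨c, hc, hlow⟩ := exists_mul_norm_le_norm_primeSeries (p := p) diskProb hp
    have hfin := hss (primeSpan circleProb p) (Submodule.isClosed_topologicalClosure _)
      -- Lower bound for `Ψ` over upper bound for `Φ`; the `+ 1` keeps the denominator positive.
      ⟨c / (‖primeSeries circleProb p‖ + 1),
        by positivity, fun x hx => ?_⟩
    · exact not_finiteDimensional_ell2 (Φ.symm.toLinearEquiv.finiteDimensional)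
    · obtain ⟨a, ha⟩ := Φ.surjective ⟨x, hx⟩
      have hxa : x = (Φ a : Hardy p) := by rw [ha]
      rw [hxa, hTΦ, hΨ, div_mul_eq_mul_div, div_le_iff₀ (by positivity)]
      calc c * ‖(Φ a : Hardy p)‖
          ≤ c * ((‖primeSeries circleProb p‖ + 1)
              * ‖a‖) := by
            gcongr
            rw [hΦ]
            exact ((primeSeries circleProb p).le_opNorm a).trans (by gcongr; linarith)
        _ = c * ‖a‖ *
            (‖primeSeries circleProb p‖ + 1) := by ring
        _ ≤ _ := by
            gcongr
            exact hlow a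
  · rw [hΦ, coeff_primeSeries hp]
  · rw [hΨ, coeff_primeSeries hp]
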